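/- Consider the deterministic LOCAL model: the network is a finite simple graph $G=(V,E)$ with $n$ nodes and maximum degree $\Delta$; the nodes have distinct identifiers from $\{1,\dots,n^c\}$, where $c\ge 1$ is a fixed integer; initially each node knows its identifier, its degree, $\Delta$ and $n$; in each synchronous round every node sends a message to each of its neighbors, receives their messages and updates its state, with no restriction on message size or local computation. For integers $p\ge q\ge 1$, a $(p:q)$-coloring of $G$ assigns to each node $v$ a set $X_v\subseteq\{1,\dots,p\}$ with $|X_v|\ge q$ such that $X_u\cap X_v=\emptyset$ for every edge $\{u,v\}$; a fractional $r$-coloring is a $(p:q)$-coloring with $p/q\le r$. Theorem. There is a function $T(\varepsilon,\Delta)\in\mathbb N$, independent of $n$ and $c$, such that for every real $\varepsilon>0$ and every integer $c\ge 1$ there is a deterministic LOCAL algorithm that, on every graph $G$ with maximum degree $\Delta\ge 3$ which, in case $\varepsilon<1$, contains no clique on $\Delta+1$ nodes, computes a fractional $(\Delta+\varepsilon)$-coloring of $G$ in $T(\varepsilon,\Delta)$ rounds, where, uniformly in all $\varepsilon>0$ and $\Delta\ge 3$, \[ T(\varepsilon,\Delta)= O\!\left(\Big(\log\Delta+\frac{\log^2(1/\varepsilon)}{\log\Delta}\Big)\cdot\log\frac{\Delta}{\varepsilon}\right)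 \quad\text{and}\quad T(\varepsilon,\Delta)= O\!\left(\log^2\Delta+\log^2\frac1\varepsilon+\frac{\log^3(1/\varepsilon)}{\log\Delta}\right). \] Here $O(f)$ stands for $O(\max\{1,f\})$, which matters only for $\varepsilon>1$; for $0<\varepsilon\le 1$ the two bounds are of the same order, that is, each is at most a universal constant times the other. In particular, for every constant $a>0$ we have $T(\varepsilon,\Delta)=O(\log^2\Delta)$ uniformly over all $\Delta\ge 3$ and $\varepsilon>1/\Delta^{a}$, with the implied constant depending only on $a$. -/

import Mathlib

universe u

/-- A deterministic algorithm in the LOCAL model with local outputs in `Out`.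
The sizes of states and messages and the local computation are unrestricted. -/
structure LocalAlgorithm (Out : Type) where
  State : Type
  Msg : Type
  /-- `init n Δ i d` is the initial state of a node with identifier `i` and degree `d` in a
  network with `n` nodes and maximum degree `Δ`; nothing else is known initially. -/
  init : (n Δ i d : ℕ) → State
  /-- `send s j` is the message that a node in state `s` sends through its port `j`. -/
  send : State → ℕ → Msg
  /-- The new state after receiving the given messages, listed in the order of the ports. -/
  receive : State → List Msg → State
  output : State → Out

/-- A port numbering: every node numbers its incident edges by `0, …, deg - 1`, arbitrarily and
independently of the other nodes; `port v j` is the neighbour of `v` behind its port `j`. -/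
abbrev PortNumbering {V : Type u} [Fintype V] (G : SimpleGraph V) [DecidableRel G.Adj] :=
  (v : V) → Fin (G.degree v) ≃ G.neighborSet v

namespace LocalAlgorithm

variable {Out : Type} {V : Type u} [Fintype V]

/-- The state of each node after `t` synchronous rounds. In a round, every node sends one message
through each of its ports, and then updates its state by the messages from all its neighbours. -/
def stateAfter (A : LocalAlgorithm Out) (G : SimpleGraph V) [DecidableRel G.Adj]
    (port : PortNumbering G) (ident : V → ℕ) : ℕ → V → A.State
  | 0, v => A.init (Fintype.card V) G.maxDegree (ident v) (G.degree v)
  | t + 1, v =>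
    A.receive (stateAfter A G port ident t v)
      (List.ofFn fun j : Fin (G.degree v) =>
        let w : G.neighborSet v := port v j
        A.send (stateAfter A G port ident t w.1) ((port w.1).symm ⟨v, w.2.symm⟩ : ℕ))

/-- The local outputs after `t` rounds. -/
def outputAfter (A : LocalAlgorithm Out) (G : SimpleGraph V) [DecidableRel G.Adj]
    (port : PortNumbering G) (ident : V → ℕ) (t : ℕ) (v : V) : Out :=
  A.output (A.stateAfter G port ident t v)

end LocalAlgorithm

/-- An assignment of distinct identifiers from `{1, …, n ^ c}`, where `n` is the number of nodes. -/
def IsIdAssignment {V : Type u} [Fintype V] (c : ℕ) (ident : V → ℕ) : Prop :=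
  Function.Injective ident ∧ ∀ v, 1 ≤ ident v ∧ ident v ≤ Fintype.card V ^ c

/-- `X` is a `(p : q)`-coloring of `G`. -/
def IsPQColoring {V : Type u} (G : SimpleGraph V) (p q : ℕ) (X : V → Finset ℕ) : Prop :=
  1 ≤ q ∧ q ≤ p ∧ (∀ v, X v ⊆ Finset.Icc 1 p) ∧ (∀ v, q ≤ (X v).card) ∧
    ∀ v w, G.Adj v w → Disjoint (X v) (X w)

/-- `X` is a fractional `r`-coloring of `G`: a `(p : q)`-coloring with `p / q ≤ r`. -/
def IsFractionalColoring {V : Type u} (G : SimpleGraph V) (r : ℝ) (X : V → Finset ℕ) : Prop :=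
  ∃ p q : ℕ, IsPQColoring G p q X ∧ (p : ℝ) / (q : ℝ) ≤ r

/-!
A random partial colouring with `Δ` colours in which every node is uncoloured with probability at
most `ε / (Δ + ε)` becomes a fractional `(Δ + ε)`-colouring when the colours of all outcomes are
collected, with a separate copy of the palette for each outcome. All nodes can do this
simultaneously for every outcome, so randomness costs nothing.

Such a partial colouring is found as follows. Remove every node with probability `1 / Q`. Around
a node there is either a small *flexible* set, which can be coloured greedily or as an even cycle
whatever colours its surroundings have, or, because `G` has no clique on `Δ + 1` nodes, the balls
grow so fast that one of them probably contains a removed node. A ruling set of disjoint flexible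
sets, together with the removed nodes, is then close to every node. The remaining nodes are coloured
by random trials, in layers by decreasing distance to this base: while a node is being coloured,
its neighbour in the next layer is still uncoloured, which leaves it a spare colour, so that a
trial succeeds with constant probability. In the end the flexible sets are coloured. Each kind of
failure has probability at most `1 / Q`, with `Q` a power of `Δ`.

For `ε ≥ 1`, a node simply takes those orderings of the identifiers in which it precedes all its
neighbours, which is a fraction of at least `1 / (Δ + 1)` of all orderings.
-/

/-! ### Views and locally computable functions -/

/-- What a node has seen of its network: its initial knowledge, extended in every round by the
views of its neighbours. -/
inductive View : Type
  | leaf (n Δ i d : ℕ) : View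
  | node (s : View) (l : List View) : View

namespace View

/-- The number of nodes, as known from a view. -/
def order : View → ℕ
  | leaf n _ _ _ => n
  | node s _ => s.order

/-- The maximum degree of the network, as known from a view. -/
def maxDegree : View → ℕ
  | leaf _ Δ _ _ => Δ
  | node s _ => s.maxDegree

section After

variable {V : Type u} [Fintype V] (G : SimpleGraph V) [DecidableRel G.Adj]
  (port : PortNumbering G) (ident : V → ℕ)

/-- The view of each node after `t` rounds. -/
def after : ℕ → V → View
  | 0, v => leaf (Fintype.card V) G.maxDegree (ident v) (G.degree v)
  | t + 1, v => node (after t v)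
      (List.ofFn fun j : Fin (G.degree v) => after t (port v j).1)

theorem order_after (t : ℕ) (v : V) : (after G port ident t v).order = Fintype.card V := by
  induction t with
  | zero => rfl
  | succ _ ih => exact ih

theorem maxDegree_after (t : ℕ) (v : V) :
    (after G port ident t v).maxDegree = G.maxDegree := by
  induction t with
  | zero => rfl
  | succ _ ih => exact ih

end After

/-- The algorithm whose nodes exchange their complete views and evaluate `out` in the end. -/
def gather {Out : Type} (out : View → Out) : LocalAlgorithm Out where
  State := View
  Msg := View
  init := leaf
  send s _ := s
  receive := node
  output := out

variable {Out : Type} (out : View → Out) {V : Type u} [Fintype V] (G : SimpleGraph V)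
  [DecidableRel G.Adj] (port : PortNumbering G) (ident : V → ℕ)

theorem stateAfter_gather (t : ℕ) :
    (gather out).stateAfter G port ident t = after G port ident t := by
  induction t with
  | zero => rfl
  | succ t ih =>
    funext v
    simp only [LocalAlgorithm.stateAfter, after, ih]
    rfl

theorem outputAfter_gather (t : ℕ) (v : V) :
    (gather out).outputAfter G port ident t v = out (after G port ident t v) :=
  congrArg out (congrFun (stateAfter_gather out G port ident t) v)

end View

/-- The node function `f` can be evaluated from the views after `t` rounds. The nodes of the
network are identified with their identifiers, which are elements of `Fin N`, so that the network
becomes a graph on `Fin N` in which the unused identifiers are isolated nodes. -/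
def LocallyComputable {N : ℕ} {X : Type} (t : ℕ) (f : SimpleGraph (Fin N) → Fin N → X) : Prop :=
  ∃ D : View → X, ∀ (V : Type u) [Fintype V] (G : SimpleGraph V) [DecidableRel G.Adj]
    (port : PortNumbering G) (e : V ↪ Fin N) (v : V),
    f (G.map e) (e v) = D (View.after G port (fun w => (e w : ℕ)) t v)

namespace LocallyComputable

variable {N : ℕ} {X Y Z : Type} {t : ℕ} {f : SimpleGraph (Fin N) → Fin N → X}
  {g : SimpleGraph (Fin N) → Fin N → Y}

theorem congr {f' : SimpleGraph (Fin N) → Fin N → X} (hf : LocallyComputable.{u} t f)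
    (h : ∀ G i, f G i = f' G i) : LocallyComputable.{u} t f' := by
  rwa [← show f = f' from funext fun G => funext (h G)]

theorem const (x : X) : LocallyComputable.{u} (N := N) t (fun _ _ => x) :=
  ⟨fun _ => x, fun _ _ _ _ _ _ _ => rfl⟩

theorem comp (φ : X → Y) (hf : LocallyComputable.{u} t f) :
    LocallyComputable.{u} t (fun G i => φ (f G i)) := by
  obtain ⟨D, hD⟩ := hf
  exact ⟨fun w => φ (D w), fun V _ G _ port e v => congrArg φ (hD V G port e v)⟩

theorem comp₂ (φ : X → Y → Z) (hf : LocallyComputable.{u} t f) (hg : LocallyComputable.{u} t g) :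
    LocallyComputable.{u} t (fun G i => φ (f G i) (g G i)) := by
  obtain ⟨D, hD⟩ := hf
  obtain ⟨E, hE⟩ := hg
  exact ⟨fun w => φ (D w) (E w), fun V _ G _ port e v =>
    congrArg₂ φ (hD V G port e v) (hE V G port e v)⟩

theorem succ (hf : LocallyComputable.{u} t f) : LocallyComputable.{u} (t + 1) f := by
  obtain ⟨D, hD⟩ := hf
  refine ⟨fun w => match w with | .leaf n Δ i d => D (.leaf n Δ i d) | .node s _ => D s, ?_⟩
  intro V _ G _ port e v
  rw [hD V G port e v]
  rfl

theorem id [NeZero N] : LocallyComputable.{u} (N := N) t (fun _ i => i) := by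
  induction t with
  | zero =>
    refine ⟨fun w => match w with | .leaf _ _ i _ => Fin.ofNat N i | .node _ _ => 0, ?_⟩
    intro V _ G _ port e v
    simp [View.after, Fin.ofNat, Nat.mod_eq_of_lt]
  | succ _ ih => exact ih.succ

theorem mem_neighborViews_iff {D : View → Fin N × X} {V : Type u} [Fintype V]
    {G : SimpleGraph V} [DecidableRel G.Adj] {port : PortNumbering G} {e : V ↪ Fin N}
    (hD : ∀ w, (e w, f (G.map e) (e w)) = D (View.after G port (fun w => (e w : ℕ)) t w))
    (v : V) (j : Fin N) (x : X) :
    (j, x) ∈ (List.ofFn fun k : Fin (G.degree v) =>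
      View.after G port (fun w => (e w : ℕ)) t (port v k).1).map D ↔
      (G.map e).Adj (e v) j ∧ f (G.map e) j = x := by
  simp only [List.mem_map, List.mem_ofFn, exists_exists_eq_and, ← hD, Prod.mk.injEq]
  constructor
  · rintro ⟨k, rfl, rfl⟩
    exact ⟨SimpleGraph.map_adj_apply.2 (port v k).2, rfl⟩
  · rintro ⟨hadj, rfl⟩
    obtain ⟨a, w, haw, ha, rfl⟩ := (SimpleGraph.map_adj ..).1 hadj
    obtain rfl := e.injective ha
    exact ⟨(port a).symm ⟨w, haw⟩, by simp⟩

open Classical in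
theorem neighborValues [NeZero N] (hf : LocallyComputable.{u} t f) :
    LocallyComputable.{u} (t + 1) (fun G i j => if G.Adj i j then some (f G j) else none) := by
  obtain ⟨D, hD⟩ := comp₂ Prod.mk id hf
  refine ⟨fun w j => match w with
    | .leaf _ _ _ _ => none
    | .node _ l => if h : ∃ x, (j, x) ∈ l.map D then some h.choose else none, ?_⟩
  intro V _ G _ port e v
  funext j
  simp only [View.after, mem_neighborViews_iff (hD V G port e)]
  split_ifs with hadj hx hx
  · exact congrArg some hx.choose_spec.2
  · exact absurd ⟨_, hadj, rfl⟩ hx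
  · exact absurd hx.choose_spec.1 hadj
  · rfl

end LocallyComputable

/-- The nodes `i` and `j` are at distance at most `r`. -/
def Near {V : Type*} (G : SimpleGraph V) (r : ℕ) (i j : V) : Prop :=
  G.edist i j ≤ r

section Near

variable {V : Type*} {G : SimpleGraph V} {r s : ℕ} {i j k : V}

theorem near_zero_iff : Near G 0 i j ↔ i = j := by
  simp [Near]

theorem near_iff_exists_walk : Near G r i j ↔ ∃ p : G.Walk i j, p.length ≤ r := by
  constructor
  · intro h
    obtain ⟨p, hp⟩ := SimpleGraph.exists_walk_of_edist_ne_top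
      (ne_top_of_le_ne_top (ENat.natCast_ne_top r) h)
    exact ⟨p, by rw [Near, ← hp] at h; exact_mod_cast h⟩
  · rintro ⟨p, hp⟩
    exact (SimpleGraph.edist_le p).trans (by exact_mod_cast hp)

namespace Near

theorem refl (i : V) : Near G r i i := by
  simp [Near]

theorem symm (h : Near G r i j) : Near G r j i := by
  rwa [Near, SimpleGraph.edist_comm]

theorem mono (h : Near G r i j) (hrs : r ≤ s) : Near G s i j :=
  h.trans (by exact_mod_cast hrs)

theorem trans (h : Near G r i j) (h' : Near G s j k) : Near G (r + s) i k := by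
  rw [Near, Nat.cast_add]
  exact SimpleGraph.edist_triangle.trans (add_le_add h h')

theorem of_adj (h : G.Adj i j) : Near G 1 i j :=
  (SimpleGraph.edist_eq_one_iff_adj.2 h).le

theorem cons (h : G.Adj i j) (h' : Near G r j k) : Near G (r + 1) i k := by
  rw [Nat.add_comm]
  exact (of_adj h).trans h'

theorem snoc (h : Near G r i j) (h' : G.Adj j k) : Near G (r + 1) i k :=
  h.trans (of_adj h')

end Near

theorem near_succ_iff : Near G (r + 1) i k ↔ Near G r i k ∨ ∃ j, G.Adj i j ∧ Near G r j k := by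
  constructor
  · intro h
    obtain ⟨p, hp⟩ := near_iff_exists_walk.1 h
    cases p with
    | nil => exact Or.inl (Near.refl _)
    | cons hij q =>
      rw [SimpleGraph.Walk.length_cons] at hp
      exact Or.inr ⟨_, hij, near_iff_exists_walk.2 ⟨q, by omega⟩⟩
  · rintro (h | ⟨j, hij, h⟩)
    · exact h.mono (Nat.le_succ r)
    · exact h.cons hij

theorem near_succ_iff' : Near G (r + 1) i k ↔ Near G r i k ∨ ∃ j, Near G r i j ∧ G.Adj j k := by
  rw [← show Near G (r + 1) k i ↔ Near G (r + 1) i k from ⟨Near.symm, Near.symm⟩, near_succ_iff]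
  exact or_congr ⟨Near.symm, Near.symm⟩ (exists_congr fun _ =>
    ⟨fun h => ⟨h.2.symm, h.1.symm⟩, fun h => ⟨h.2.symm, h.1.symm⟩⟩)

end Near

/-- The graphs `G` and `G'` have the same edges at all nodes at distance at most `r` from `i`. -/
def AgreeNear {V : Type*} (r : ℕ) (G G' : SimpleGraph V) (i : V) : Prop :=
  ∀ j, Near G r i j → ∀ k, G.Adj j k ↔ G'.Adj j k

namespace AgreeNear

variable {V : Type*} {G G' : SimpleGraph V} {r s : ℕ} {i j k : V}

theorem mono (h : AgreeNear s G G' i) (hrs : r ≤ s) : AgreeNear r G G' i :=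
  fun j hj => h j (hj.mono hrs)

theorem shift (h : AgreeNear (r + s) G G' i) (hj : Near G r i j) : AgreeNear s G G' j :=
  fun k hk => h k (hj.trans hk)

theorem adj_iff (h : AgreeNear r G G' i) : G.Adj i k ↔ G'.Adj i k :=
  h i (Near.refl i) k

theorem near_iff (h : AgreeNear r G G' i) : Near G r i k ↔ Near G' r i k := by
  induction r generalizing i with
  | zero => simp only [near_zero_iff]
  | succ r ih =>
    rw [near_succ_iff, near_succ_iff, ih (h.mono r.le_succ)]
    refine or_congr Iff.rfl (exists_congr fun j => ?_)
    rw [← h.adj_iff]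
    rw [Nat.add_comm] at h
    exact and_congr_right fun hij => ih (h.shift (Near.of_adj hij))

end AgreeNear

/-- The value of the node function `f` at `i` depends only on the edges at the nodes at distance
at most `r` from `i`. -/
def IsLocal {V X : Type*} (r : ℕ) (f : SimpleGraph V → V → X) : Prop :=
  ∀ ⦃G G' i⦄, AgreeNear r G G' i → f G i = f G' i

namespace IsLocal

variable {V X Y : Type*} {r s : ℕ} {f : SimpleGraph V → V → X}

theorem mono (hf : IsLocal r f) (hrs : r ≤ s) : IsLocal s f :=
  fun _ _ _ h => hf (h.mono hrs)

theorem eq_of_near (hf : IsLocal s f) {G G' : SimpleGraph V} {i j : V}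
    (h : AgreeNear (r + s) G G' i) (hj : Near G r i j) : f G j = f G' j :=
  hf (h.shift hj)

end IsLocal

namespace LocallyComputable

variable {N : ℕ} [NeZero N] {X : Type} {r : ℕ} {f : SimpleGraph (Fin N) → Fin N → X}

theorem adj : LocallyComputable.{u} (N := N) 1 (fun G i j => G.Adj i j) := by
  classical
  refine (comp (fun (F : Fin N → Option Unit) j => F j = some ())
    (neighborValues (const (t := 0) ()))).congr fun G i => ?_
  simp

theorem edgesNear : LocallyComputable.{u} (N := N) (r + 1)
    (fun G i (p : Fin N × Fin N) => Near G r i p.1 ∧ G.Adj p.1 p.2) := by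
  classical
  induction r with
  | zero =>
    refine (comp₂ (fun (i : Fin N) (A : Fin N → Prop) (p : Fin N × Fin N) => i = p.1 ∧ A p.2)
      id adj).congr fun G i => funext fun p => propext ?_
    rw [near_zero_iff]
    exact and_congr_right fun hi => by rw [hi]
  | succ r ih =>
    refine (comp₂ (fun (A : Fin N × Fin N → Prop) (F : Fin N → Option (Fin N × Fin N → Prop)) p =>
      A p ∨ ∃ j E, F j = some E ∧ E p) ih.succ (neighborValues ih)).congr
        fun G i => funext fun p => propext ?_
    simp only [Option.ite_none_right_eq_some, Option.some.injEq]
    rw [near_succ_iff, or_and_right]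
    refine or_congr Iff.rfl ⟨?_, ?_⟩
    · rintro ⟨j, E, ⟨hij, rfl⟩, hjp, hp⟩
      exact ⟨⟨j, hij, hjp⟩, hp⟩
    · rintro ⟨⟨j, hij, hjp⟩, hp⟩
      exact ⟨j, _, ⟨hij, rfl⟩, hjp, hp⟩

/-- A node evaluates `f` on the graph whose edges are those that it has seen. -/
theorem of_isLocal (hf : IsLocal r f) : LocallyComputable.{u} (r + 1) f := by
  refine (comp₂ (fun (E : Fin N × Fin N → Prop) i =>
    f (SimpleGraph.fromRel fun j k => E (j, k)) i) edgesNear id).congr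
      fun G i => (hf fun j hj k => ?_).symm
  simp only [SimpleGraph.fromRel_adj]
  constructor
  · exact fun hjk => ⟨hjk.ne, Or.inl ⟨hj, hjk⟩⟩
  · rintro ⟨_, ⟨_, hjk⟩ | ⟨_, hkj⟩⟩
    · exact hjk
    · exact hkj.symm

end LocallyComputable

/-! ### List colouring of even cycles -/

/-- The number of neighbours of `v` in `F`. -/
noncomputable def degIn {V : Type*} (G : SimpleGraph V) (F : Set V) (v : V) : ℕ :=
  (G.neighborSet v ∩ F).ncard

/-- The restriction of `c` to the set `F` of nodes is a proper colouring from the lists `L`. -/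
def IsListColoring {V K : Type*} (G : SimpleGraph V) (F : Set V) (L : V → Finset K) (c : V → K) :
    Prop :=
  (∀ v ∈ F, c v ∈ L v) ∧ ∀ v ∈ F, ∀ w ∈ F, G.Adj v w → c v ≠ c w

/-- The set `F` of nodes can be properly coloured from the lists `L`. -/
def ListColorable {V K : Type*} (G : SimpleGraph V) (F : Set V) (L : V → Finset K) : Prop :=
  ∃ c : V → K, IsListColoring G F L c

open Classical in
/-- The lists that remain after an independent set `P` has been coloured with `x`. -/
noncomputable def listAfter {V K : Type*} (G : SimpleGraph V) (P : Set V) (x : K)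
    (L : V → Finset K) (v : V) : Finset K :=
  if ∃ p ∈ P, G.Adj v p then (L v).erase x else L v

section ListColoring

variable {V K : Type*} {G : SimpleGraph V} {F F' P : Set V} {L : V → Finset K} {x : K} {p q v : V}

theorem IsListColoring.congr {G' : SimpleGraph V} {L' : V → Finset K}
    (hL : ∀ v ∈ F, L v = L' v) (hG : ∀ v ∈ F, ∀ w, G.Adj v w ↔ G'.Adj v w) :
    IsListColoring G F L = IsListColoring G' F L' := by
  funext c
  refine propext (and_congr (forall₂_congr fun v hv => by rw [hL v hv])
    (forall₂_congr fun v hv => forall₂_congr fun w _ => by rw [hG v hv w]))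

theorem degIn_mono [Finite V] (h : F ⊆ F') (v : V) : degIn G F v ≤ degIn G F' v :=
  Set.ncard_le_ncard (Set.inter_subset_inter_right _ h)

theorem degIn_add_degIn_compl [Finite V] (G : SimpleGraph V) (F : Set V) (v : V) :
    degIn G F v + degIn G Fᶜ v = (G.neighborSet v).ncard :=
  Set.ncard_inter_add_ncard_sdiff_eq_ncard _ _

theorem degIn_diff_lt [Finite V] (hpF : p ∈ F) (hpP : p ∈ P) (h : G.Adj v p) :
    degIn G (F \ P) v < degIn G F v :=
  Set.ncard_lt_ncard ⟨Set.inter_subset_inter_right _ Set.sdiff_subset,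
    fun hs => (hs ⟨h, hpF⟩).2.2 hpP⟩

theorem degIn_diff_add_two_le [Finite V] (hpF : p ∈ F) (hpP : p ∈ P) (hp : G.Adj v p)
    (hqF : q ∈ F) (hqP : q ∈ P) (hq : G.Adj v q) (hpq : p ≠ q) :
    degIn G (F \ P) v + 2 ≤ degIn G F v := by
  have hsub : F \ P ⊆ (F \ {p}) \ {q} := fun w hw =>
    ⟨⟨hw.1, fun e => hw.2 (e ▸ hpP)⟩, fun e => hw.2 (e ▸ hqP)⟩
  have h₁ := degIn_mono (G := G) hsub v
  have h₂ : degIn G ((F \ {p}) \ {q}) v < degIn G (F \ {p}) v :=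
    degIn_diff_lt ⟨hqF, hpq.symm⟩ rfl hq
  have h₃ : degIn G (F \ {p}) v < degIn G F v := degIn_diff_lt hpF rfl hp
  omega

theorem card_le_card_listAfter_add_one (P : Set V) (x : K) (L : V → Finset K) (v : V) :
    (L v).card ≤ (listAfter G P x L v).card + 1 := by
  classical
  unfold listAfter
  split_ifs
  · have := Finset.pred_card_le_card_erase (s := L v) (a := x)
    omega
  · omega

theorem listAfter_of_not_adj (h : ∀ p ∈ P, ¬ G.Adj v p) : listAfter G P x L v = L v :=
  if_neg (by simpa using h)

theorem listAfter_of_notMem (hx : x ∉ L v) : listAfter G P x L v = L v := by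
  classical
  rw [listAfter, Finset.erase_eq_of_notMem hx, ite_self]

/-- A node loses at most one colour, and only if it also loses a neighbour. -/
theorem degIn_diff_add_card_le [Finite V] (hPF : P ⊆ F) :
    degIn G (F \ P) v + (L v).card ≤ degIn G F v + (listAfter G P x L v).card := by
  by_cases h : ∃ p ∈ P, G.Adj v p
  · obtain ⟨p, hp, hvp⟩ := h
    have h₁ := degIn_diff_lt (hPF hp) hp hvp
    have h₂ := card_le_card_listAfter_add_one (G := G) P x L v
    omega
  · rw [listAfter_of_not_adj (by simpa using h)]
    exact Nat.add_le_add_right (degIn_mono Set.sdiff_subset v) _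

theorem ListColorable.of_diff (hx : ∀ p ∈ P, x ∈ L p) (hP : G.IsIndepSet P)
    (h : ListColorable G (F \ P) (listAfter G P x L)) : ListColorable G F L := by
  classical
  obtain ⟨c, hc, hproper⟩ := h
  have hmem : ∀ v ∈ F, v ∉ P → c v ∈ L v ∧ ∀ p ∈ P, G.Adj v p → c v ≠ x := by
    intro v hv hvP
    have hcv := hc v ⟨hv, hvP⟩
    unfold listAfter at hcv
    split_ifs at hcv with hadj
    · exact ⟨Finset.mem_of_mem_erase hcv, fun _ _ _ => Finset.ne_of_mem_erase hcv⟩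
    · exact ⟨hcv, fun p hp hvp => absurd ⟨p, hp, hvp⟩ hadj⟩
  refine ⟨fun v => if v ∈ P then x else c v, fun v hv => ?_, fun v hv w hw hvw => ?_⟩
  · by_cases hvP : v ∈ P
    · simpa only [hvP, if_true] using hx v hvP
    · simpa only [hvP, if_false] using (hmem v hv hvP).1
  · by_cases hvP : v ∈ P <;> by_cases hwP : w ∈ P <;> simp only [hvP, hwP, if_true, if_false]
    · exact absurd hvw (hP hvP hwP hvw.ne)
    · exact ((hmem w hw hwP).2 v hvP hvw.symm).symm
    · exact (hmem v hv hvP).2 w hwP hvw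
    · exact hproper v ⟨hv, hvP⟩ w ⟨hw, hwP⟩ hvw

/-- The nodes are coloured by decreasing rank: a node without a spare colour has an uncoloured
neighbour when its turn comes. -/
theorem listColorable_of_rank [Finite V] [Nonempty K] (ρ : V → ℕ) (F : Set V) (L : V → Finset K)
    (hL : ∀ v ∈ F, degIn G F v ≤ (L v).card)
    (h : ∀ v ∈ F, degIn G F v < (L v).card ∨ ∃ u ∈ F, G.Adj v u ∧ ρ u < ρ v) :
    ListColorable G F L := by
  induction hn : F.ncard generalizing F L with
  | zero =>
    obtain rfl := (Set.ncard_eq_zero F.toFinite).1 hn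
    exact ⟨fun _ => Classical.arbitrary K, by simp, by simp⟩
  | succ n ih =>
    obtain ⟨v, hv, hmax⟩ := F.exists_max_image ρ F.toFinite
      (Set.nonempty_of_ncard_ne_zero (by omega))
    have hpos : 0 < (L v).card := by
      rcases h v hv with h | ⟨u, hu, hvu, _⟩
      · omega
      · have hu' : u ∈ G.neighborSet v ∩ F := ⟨hvu, hu⟩
        exact ((Set.ncard_pos (Set.toFinite _)).2 ⟨u, hu'⟩).trans_le (hL v hv)
    obtain ⟨x, hx⟩ := Finset.card_pos.1 hpos
    have hcard (w : V) := degIn_diff_add_card_le (G := G) (L := L) (x := x) (v := w)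
      (Set.singleton_subset_iff.2 hv)
    refine ListColorable.of_diff (P := {v}) (x := x) (by simpa using hx) (by simp)
      (ih _ _ (fun w hw => ?_) (fun w hw => ?_) ?_)
    · have := hL w hw.1
      have := hcard w
      omega
    · refine (h w hw.1).imp (fun h => ?_) ?_
      · have := hcard w
        omega
      · rintro ⟨u, hu, hwu, hρ⟩
        refine ⟨u, ⟨hu, ?_⟩, hwu, hρ⟩
        rintro rfl
        exact absurd (hmax w hw.1) hρ.not_ge
    · rw [Set.ncard_sdiff_singleton_of_mem hv, hn, Nat.add_sub_cancel]

theorem listColorable_of_precoloring [Finite V] [Nonempty K] (ρ : V → ℕ) (hPF : P ⊆ F)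
    (hx : ∀ p ∈ P, x ∈ L p) (hP : G.IsIndepSet P) (hL : ∀ v ∈ F, degIn G F v ≤ (L v).card)
    (h : ∀ v ∈ F \ P, (∃ u ∈ F \ P, G.Adj v u ∧ ρ u < ρ v) ∨
      (x ∉ L v ∧ ∃ p ∈ P, G.Adj v p) ∨ ∃ p ∈ P, ∃ q ∈ P, p ≠ q ∧ G.Adj v p ∧ G.Adj v q) :
    ListColorable G F L := by
  refine ListColorable.of_diff hx hP (listColorable_of_rank ρ _ _ (fun v hv => ?_) fun v hv => ?_)
  · have := degIn_diff_add_card_le (G := G) (L := L) (x := x) (v := v) hPF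
    have := hL v hv.1
    omega
  have hLv := hL v hv.1
  rcases h v hv with h | ⟨hxv, p, hp, hvp⟩ | ⟨p, hp, q, hq, hpq, hvp, hvq⟩
  · exact Or.inr h
  · left
    rw [listAfter_of_notMem hxv]
    exact (degIn_diff_lt (hPF hp) hp hvp).trans_le hLv
  · left
    have := degIn_diff_add_two_le (hPF hp) hp hvp (hPF hq) hq hvq hpq
    have := card_le_card_listAfter_add_one (G := G) P x L v
    omega

theorem degIn_image {W : Type*} (f : W ↪ V) (F : Set W) (v : W) :
    degIn G (f '' F) (f v) = degIn (G.comap f) F v := by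
  rw [degIn, degIn, ← Set.ncard_image_of_injective _ f.injective]
  congr 1
  ext w
  constructor
  · rintro ⟨hvw, u, hu, rfl⟩
    exact ⟨u, ⟨hvw, hu⟩, rfl⟩
  · rintro ⟨u, ⟨hvu, hu⟩, rfl⟩
    exact ⟨hvu, u, hu, rfl⟩

theorem ListColorable.image [Nonempty K] {W : Type*} (f : W ↪ V) {F : Set W}
    (h : ListColorable (G.comap f) F (L ∘ f)) : ListColorable G (f '' F) L := by
  obtain ⟨c, hc, hproper⟩ := h
  have hcf (w : W) : Function.extend f c (fun _ => Classical.arbitrary K) (f w) = c w :=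
    f.injective.extend_apply _ _ _
  refine ⟨Function.extend f c fun _ => Classical.arbitrary K, ?_, ?_⟩
  · rintro _ ⟨v, hv, rfl⟩
    rw [hcf]
    exact hc v hv
  · rintro _ ⟨v, hv, rfl⟩ _ ⟨w, hw, rfl⟩ hvw
    rw [hcf, hcf]
    exact hproper v hv w hw hvw

end ListColoring

/-- The order in which the nodes of a cycle through a chord from `s` to a node before `t` are
reached from the node `1` on the paths that avoid the nodes `0` and `t`. -/
def chordRank (s t k : ℕ) : ℕ :=
  if k < t then k else t + (k - s) + (s - k)

section Cycle

variable {n : ℕ} [NeZero n] {K : Type*} {H : SimpleGraph (ZMod n)}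
  (hadj : ∀ i, H.Adj i (i + 1)) {L : ZMod n → Finset K} {A : Finset K}

theorem val_sub_one_lt {i : ZMod n} (hi : i ≠ 0) : (i - 1).val < i.val := by
  have hpos : 0 < i.val := Nat.pos_of_ne_zero ((ZMod.val_ne_zero i).2 hi)
  have hi' : i - 1 = ((i.val - 1 : ℕ) : ZMod n) := by
    rw [Nat.cast_sub hpos, ZMod.natCast_zmod_val, Nat.cast_one]
  rw [hi', ZMod.val_natCast_of_lt ((Nat.sub_le _ _).trans_lt i.val_lt)]
  omega

include hadj

omit [NeZero n] in
theorem adj_sub_one (i : ZMod n) : H.Adj i (i - 1) := by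
  simpa using (hadj (i - 1)).symm

theorem listColorable_cycle_of_spare [Nonempty K] (hL : ∀ i, degIn H Set.univ i ≤ (L i).card)
    {i : ZMod n} (hi : degIn H Set.univ i < (L i).card) : ListColorable H Set.univ L := by
  refine listColorable_of_rank (fun j => (j - i).val) _ L (fun j _ => hL j) fun j _ => ?_
  by_cases hj : j = i
  · exact Or.inl (hj ▸ hi)
  · refine Or.inr ⟨j - 1, Set.mem_univ _, adj_sub_one hadj j, ?_⟩
    rw [sub_right_comm]
    exact val_sub_one_lt (sub_ne_zero.2 hj)

theorem listColorable_cycle_of_not_subset [Nonempty K] (hL : ∀ i, degIn H Set.univ i ≤ (L i).card)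
    {i : ZMod n} (hi : ¬ L i ⊆ L (i + 1)) : ListColorable H Set.univ L := by
  obtain ⟨x, hx, hx'⟩ := Finset.not_subset.1 hi
  refine listColorable_of_precoloring (fun j => (j - (i + 1)).val) (P := {i}) (x := x)
    (Set.subset_univ _) (by simpa using hx) (by simp) (fun j _ => hL j) fun j ⟨_, hji⟩ => ?_
  by_cases hj : j = i + 1
  · subst hj
    exact Or.inr (Or.inl ⟨hx', i, rfl, (hadj i).symm⟩)
  · refine Or.inl ⟨j - 1, ⟨Set.mem_univ _, fun e => hj (sub_eq_iff_eq_add.1 e)⟩,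
      adj_sub_one hadj j, ?_⟩
    rw [sub_right_comm]
    exact val_sub_one_lt (sub_ne_zero.2 hj)

omit [NeZero n] in
theorem adj_natCast_succ (k : ℕ) : H.Adj (k : ZMod n) ((k + 1 : ℕ) : ZMod n) := by
  simpa using hadj k

omit [NeZero n] in
theorem exists_adj_chordRank_lt {r s t k : ℕ} (hr : 1 ≤ r) (hrt : r < t) (hts : t < s)
    (hsn : s < n) (hrs : H.Adj r s) (hk : 1 < k) (hkt : k ≠ t) (hkn : k < n) :
    ∃ j < n, j ≠ 0 ∧ j ≠ t ∧ H.Adj (k : ZMod n) j ∧ chordRank s t j < chordRank s t k := by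
  unfold chordRank
  have hpred : H.Adj (k : ZMod n) (k - 1 : ℕ) := by
    simpa [Nat.sub_add_cancel hk.le] using (adj_natCast_succ hadj (k - 1)).symm
  rcases lt_trichotomy k s with hks | rfl | hks
  · rcases lt_or_gt_of_ne hkt with hkt | hkt
    · exact ⟨k - 1, by grind⟩
    · exact ⟨k + 1, by omega, by omega, by omega, adj_natCast_succ hadj k, by grind⟩
  · exact ⟨r, by omega, by omega, by omega, hrs.symm, by grind⟩
  · exact ⟨k - 1, by grind⟩

/-- The nodes `0` and `t` receive the same colour, which leaves a spare colour at their common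
neighbour `1`. -/
theorem listColorable_cycle_of_chord (hA : ∀ i, degIn H Set.univ i ≤ A.card) {r s t : ℕ}
    (hr : 1 ≤ r) (hrt : r < t) (hts : t < s) (hsn : s < n) (h0t : ¬ H.Adj 0 t) (h1t : H.Adj 1 t)
    (hrs : H.Adj r s) : ListColorable H Set.univ fun _ => A := by
  have cast_inj {j k : ℕ} (hj : j < n) (hk : k < n) (h : (j : ZMod n) = k) : j = k := by
    rw [← ZMod.val_natCast_of_lt hj, h, ZMod.val_natCast_of_lt hk]
  have hdeg1 : 0 < degIn H Set.univ 1 := (Set.ncard_pos (Set.toFinite _)).2 ⟨t, h1t, trivial⟩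
  obtain ⟨x, hx⟩ := Finset.card_pos.1 (hdeg1.trans_le (hA 1))
  have : Nonempty K := ⟨x⟩
  refine listColorable_of_precoloring (fun i => chordRank s t i.val) (P := {0, (t : ZMod n)})
    (x := x) (Set.subset_univ _) (fun _ _ => hx) ?_ (fun i _ => hA i) fun i hi => ?_
  · simpa [Set.pairwise_insert, SimpleGraph.isIndepSet_iff, H.adj_comm (t : ZMod n)] using
      fun _ => h0t
  obtain ⟨k, hk, rfl⟩ : ∃ k < n, (k : ZMod n) = i := ⟨i.val, i.val_lt, ZMod.natCast_zmod_val i⟩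
  have hP {j : ℕ} (hj : j < n) (hj0 : j ≠ 0) (hjt : j ≠ t) :
      (j : ZMod n) ∈ Set.univ \ {0, (t : ZMod n)} := by
    refine ⟨trivial, ?_⟩
    rintro (h | h)
    · exact hj0 (cast_inj hj (NeZero.pos n) (by simpa using h))
    · exact hjt (cast_inj hj (hts.trans hsn) h)
  have hk0 : k ≠ 0 := by rintro rfl; simp at hi
  have hkt : k ≠ t := by rintro rfl; simp at hi
  by_cases hk1 : k = 1
  · subst hk1
    refine Or.inr (Or.inr ⟨0, by simp, t, by simp, ?_, by simpa using (hadj 0).symm, by simpa⟩)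
    exact fun h => absurd (cast_inj (NeZero.pos n) (hts.trans hsn) (by simpa using h)) (by omega)
  obtain ⟨j, hjn, hj0, hjt, hkj, hlt⟩ :=
    exists_adj_chordRank_lt hadj hr hrt hts hsn hrs (by omega : 1 < k) hkt hk
  refine Or.inl ⟨j, hP hjn hj0 hjt, hkj, ?_⟩
  rwa [ZMod.val_natCast_of_lt hk, ZMod.val_natCast_of_lt hjn]

theorem eq_add_one_or_eq_sub_one_of_degIn_le_two (hn : 2 < n) {i j : ZMod n}
    (hi : degIn H Set.univ i ≤ 2) (hij : H.Adj i j) : j = i + 1 ∨ j = i - 1 := by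
  have hne : i + 1 ≠ i - 1 := by
    rw [Ne, ← sub_eq_zero, add_sub_sub_cancel, one_add_one_eq_two, ← Nat.cast_two,
      ZMod.natCast_eq_zero_iff]
    exact Nat.not_dvd_of_pos_of_lt two_pos hn
  have hsub : {i + 1, i - 1} ⊆ H.neighborSet i := by
    rintro _ (rfl | rfl)
    exacts [hadj i, adj_sub_one hadj i]
  rw [degIn, Set.inter_univ] at hi
  have heq := Set.eq_of_subset_of_ncard_le hsub (hi.trans_eq (Set.ncard_pair hne).symm)
  have hj : j ∈ H.neighborSet i := hij
  rwa [← heq] at hj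

theorem listColorable_cycle_of_card_eq_two (hn : 2 < n) (heven : Even n) (hA : A.card = 2)
    (hdeg : ∀ i, degIn H Set.univ i ≤ 2) : ListColorable H Set.univ fun _ => A := by
  classical
  obtain ⟨a, b, hab, rfl⟩ := Finset.card_eq_two.1 hA
  let parity : ZMod n →+* ZMod 2 := ZMod.castHom heven.two_dvd _
  refine ⟨fun i => if parity i = 0 then a else b, fun i _ => ?_, fun i _ j _ hij => ?_⟩
  · dsimp only
    split_ifs <;> simp
  have hparity : parity j = parity i + 1 := by
    rcases eq_add_one_or_eq_sub_one_of_degIn_le_two hadj hn (hdeg i) hij with rfl | rfl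
    · rw [map_add, map_one]
    · rw [map_sub, map_one, CharTwo.sub_eq_add]
  have h01 : ∀ z : ZMod 2, z = 0 ∧ z + 1 ≠ 0 ∨ z ≠ 0 ∧ z + 1 = 0 := by decide
  rcases h01 (parity i) with h | h <;> simp [hparity, h, hab, hab.symm]

theorem neighborSet_one_eq_pair (h12 : H.Adj 1 2) (hlt : ∀ k < n, H.Adj 1 k → k < 3) :
    H.neighborSet 1 = {0, 2} := by
  ext i
  obtain ⟨k, hk, rfl⟩ : ∃ k < n, (k : ZMod n) = i := ⟨i.val, i.val_lt, ZMod.natCast_zmod_val i⟩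
  constructor
  · intro h1k
    have hk3 : k < 3 := hlt k hk h1k
    interval_cases k
    · simp
    · exact absurd h1k (by simp)
    · simp
  · rintro (h | h) <;> rw [h]
    · simpa using (hadj 0).symm
    · exact h12

theorem listColorable_cycle_of_minimal_gap (heven : Even n)
    (hA : ∀ i, degIn H Set.univ i = A.card) {t : ℕ} (ht : 2 ≤ t) (htn : t < n)
    (h0t : ¬ H.Adj 0 t) (hmin : ∀ s, 1 ≤ s → s < t → ∀ i, H.Adj i (i + s)) :
    ListColorable H Set.univ fun _ => A := by
  have htn' : t + 1 ≠ n := by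
    rintro rfl
    refine h0t ?_
    have ht0 : (t : ZMod (t + 1)) + 1 = 0 := by exact_mod_cast ZMod.natCast_self (t + 1)
    rw [eq_sub_of_add_eq ht0]
    exact adj_sub_one hadj 0
  have h1t : H.Adj 1 t := by
    have := hmin (t - 1) (by omega) (by omega) 1
    rwa [Nat.cast_sub (by omega), Nat.cast_one, add_sub_cancel] at this
  have hle (i : ZMod n) : degIn H Set.univ i ≤ A.card := (hA i).le
  by_cases hs : ∃ s, 3 ≤ s ∧ s < n ∧ H.Adj 1 s ∧ t = 2
  · obtain ⟨s, hs, hsn, h1s, rfl⟩ := hs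
    exact listColorable_cycle_of_chord hadj hle le_rfl ht hs hsn h0t h1t (by simpa using h1s)
  rcases Nat.lt_or_ge 2 t with ht2 | ht2
  · refine listColorable_cycle_of_chord hadj hle (r := t - 1) (s := t + 1) (by omega) (by omega)
      (by omega) (by omega) h0t h1t ?_
    convert hmin 2 (by omega) ht2 (t - 1 : ℕ) using 1
    rw [← Nat.cast_add]
    congr 1
    omega
  obtain rfl : t = 2 := by omega
  have hneighbors : H.neighborSet 1 = {0, 2} :=
    neighborSet_one_eq_pair hadj (by simpa using h1t) fun k hk h1k =>
      by_contra fun h => hs ⟨k, by omega, hk, h1k, rfl⟩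
  have hA2 : A.card = 2 := by
    rw [← hA 1, degIn, Set.inter_univ, hneighbors, Set.ncard_pair]
    intro h
    exact absurd (Nat.le_of_dvd two_pos ((ZMod.natCast_eq_zero_iff 2 n).1 (by simpa using h.symm)))
      (by omega)
  exact listColorable_cycle_of_card_eq_two hadj htn heven hA2 fun i => (hA i).trans_le hA2.le

omit hadj in
theorem exists_minimal_gap (hna : ∃ i j, i ≠ j ∧ ¬ H.Adj i j) :
    ∃ t, 1 ≤ t ∧ t < n ∧ (∃ i, ¬ H.Adj i (i + (t : ZMod n))) ∧
      ∀ s : ℕ, 1 ≤ s → s < t → ∀ i, H.Adj i (i + (s : ZMod n)) := by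
  classical
  have hgap : ∃ t : ℕ, 1 ≤ t ∧ t < n ∧ ∃ i, ¬ H.Adj i (i + (t : ZMod n)) := by
    obtain ⟨i, j, hij, hna⟩ := hna
    refine ⟨(j - i).val, Nat.pos_of_ne_zero ?_, (j - i).val_lt, i, by simpa using hna⟩
    exact (ZMod.val_ne_zero _).2 (sub_ne_zero.2 hij.symm)
  obtain ⟨h1, hn, hi⟩ := Nat.find_spec hgap
  refine ⟨Nat.find hgap, h1, hn, hi, fun s hs hst i => ?_⟩
  by_contra hsi
  exact Nat.find_min hgap hst ⟨hs, by omega, i, hsi⟩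

theorem listColorable_cycle_of_constant_list [Nonempty K] (heven : Even n)
    (hna : ∃ i j, i ≠ j ∧ ¬ H.Adj i j) (hA : ∀ i, degIn H Set.univ i = A.card) :
    ListColorable H Set.univ fun _ => A := by
  obtain ⟨t, ht1, htn, ⟨i, hi⟩, hmin⟩ := exists_minimal_gap hna
  have ht : t ≠ 1 := by
    rintro rfl
    exact hi (by simpa using hadj i)
  let rotation : ZMod n ↪ ZMod n := (Equiv.addLeft i).toEmbedding
  have huniv : rotation '' Set.univ = Set.univ :=
    Set.image_univ_of_surjective (Equiv.addLeft i).surjective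
  rw [← huniv]
  refine ListColorable.image rotation (listColorable_cycle_of_minimal_gap (fun j => ?_) heven
    (fun j => ?_) (by omega : 2 ≤ t) htn (by simpa [rotation] using hi) fun s hs hst j => ?_)
  · simpa [rotation, add_assoc] using hadj (i + j)
  · rw [← degIn_image, huniv, hA]
  · simpa [rotation, add_assoc] using hmin s hs hst (i + j)

theorem listColorable_cycle_of_even [Nonempty K] (heven : Even n) (hna : ∃ i j, i ≠ j ∧ ¬ H.Adj i j)
    (hL : ∀ i, degIn H Set.univ i ≤ (L i).card) : ListColorable H Set.univ L := by
  by_contra hcon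
  have hcard (i : ZMod n) : degIn H Set.univ i = (L i).card :=
    (hL i).antisymm (not_lt.1 fun hi => hcon (listColorable_cycle_of_spare hadj hL hi))
  have hsub (i : ZMod n) : L i ⊆ L (i + 1) :=
    by_contra fun hi => hcon (listColorable_cycle_of_not_subset hadj hL hi)
  have hsub' (i : ZMod n) (k : ℕ) : L i ⊆ L (i + k) := by
    induction k with
    | zero => simp
    | succ k ih => simpa [add_assoc] using ih.trans (hsub (i + k))
  have hle (i j : ZMod n) : L i ⊆ L j := by
    simpa using hsub' i (j - i).val
  have hconst : L = fun _ => L 0 := funext fun i => (hle i 0).antisymm (hle 0 i)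
  refine hcon ?_
  rw [hconst]
  exact listColorable_cycle_of_constant_list hadj heven hna fun i => by rw [hcard, hconst]

end Cycle

/-- Every colouring of a part of the nodes outside `F` with `Δ` colours, in which the nodes of `F`
see at most one colour per neighbour, leaves lists from which `F` can be coloured. -/
def Flexible {V : Type*} (Δ : ℕ) (G : SimpleGraph V) (F : Set V) : Prop :=
  ∀ L : V → Finset (Fin Δ), (∀ v ∈ F, Δ ≤ (L v).card + degIn G Fᶜ v) → ListColorable G F L

section Flexible

variable {V : Type*} {G : SimpleGraph V} {Δ : ℕ}

theorem Flexible.congr {G' : SimpleGraph V} {F : Set V}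
    (hG : ∀ v ∈ F, ∀ w, G.Adj v w ↔ G'.Adj v w) : Flexible Δ G F ↔ Flexible Δ G' F := by
  have hnbr : ∀ v ∈ F, G.neighborSet v = G'.neighborSet v := fun v hv => Set.ext (hG v hv)
  refine forall_congr' fun L => imp_congr (forall₂_congr fun v hv => ?_) ?_
  · rw [degIn, degIn, hnbr v hv]
  · rw [ListColorable, ListColorable, IsListColoring.congr (fun _ _ => rfl) hG]

variable [Finite V]

theorem flexible_singleton {v : V} (h : (G.neighborSet v).ncard < Δ) : Flexible Δ G {v} := by
  have : NeZero Δ := ⟨by omega⟩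
  intro L hL
  have hLv := hL v rfl
  have hdeg := degIn_add_degIn_compl G {v} v
  refine listColorable_of_rank (fun _ => 0) _ _ ?_ ?_ <;> rintro _ rfl
  · omega
  · exact Or.inl (by omega)

theorem flexible_range_of_cycle (hΔ : ∀ v, (G.neighborSet v).ncard ≤ Δ) {n : ℕ} [NeZero n]
    (f : ZMod n ↪ V) (hadj : ∀ i, G.Adj (f i) (f (i + 1))) (heven : Even n)
    (hna : ∃ i j, i ≠ j ∧ ¬ G.Adj (f i) (f j)) : Flexible Δ G (Set.range f) := by
  have : NeZero Δ := by
    refine ⟨((Set.ncard_pos (Set.toFinite _)).2 ?_).trans_le (hΔ (f 0)) |>.ne'⟩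
    exact ⟨f (0 + 1), hadj 0⟩
  intro L hL
  rw [← Set.image_univ]
  refine ListColorable.image f
    (listColorable_cycle_of_even (H := G.comap f) hadj heven hna fun i => ?_)
  have hLi := hL (f i) ⟨i, rfl⟩
  have hdeg := degIn_add_degIn_compl G (Set.range f) (f i)
  have hΔi := hΔ (f i)
  rw [← degIn_image, Set.image_univ, Function.comp_apply]
  omega

theorem flexible_of_chain (hΔ : ∀ v, (G.neighborSet v).ncard ≤ Δ) {l : List V} (hnd : l.Nodup)
    (hch : l.IsChain G.Adj) (hne : l ≠ []) (hclosed : G.Adj (l.getLast hne) (l.head hne))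
    (heven : Even l.length) (hna : ∃ v ∈ l, ∃ w ∈ l, v ≠ w ∧ ¬ G.Adj v w) :
    Flexible Δ G {v | v ∈ l} := by
  have : NeZero l.length := ⟨mt List.length_eq_zero_iff.1 hne⟩
  let f : ZMod l.length ↪ V :=
    ⟨fun i => l[i.val]'i.val_lt, fun i j h => ZMod.val_injective _ (hnd.getElem_inj_iff.1 h)⟩
  have hf {i : ZMod l.length} {k : ℕ} (hk : k < l.length) (h : i.val = k) : f i = l[k] := by
    subst h
    rfl
  have hrange : Set.range f = {v | v ∈ l} := by
    ext v
    simp only [Set.mem_range, Set.mem_ofPred_eq, List.mem_iff_getElem]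
    constructor
    · rintro ⟨i, rfl⟩
      exact ⟨i.val, i.val_lt, rfl⟩
    · rintro ⟨k, hk, rfl⟩
      exact ⟨k, hf hk (ZMod.val_natCast_of_lt hk)⟩
  have hadj (i : ZMod l.length) : G.Adj (f i) (f (i + 1)) := by
    have hval : (i + 1).val = (i.val + 1) % l.length := by
      rw [ZMod.val_add, ZMod.val_one_eq_one_mod, Nat.add_mod_mod]
    have hlt := i.val_lt
    rcases Nat.lt_or_ge (i.val + 1) l.length with h | h
    · rw [hf h (hval.trans (Nat.mod_eq_of_lt h))]
      exact List.isChain_iff_getElem.1 hch _ h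
    · have hi : i.val + 1 = l.length := by omega
      rw [hf (NeZero.pos _) (hval.trans (by rw [hi, Nat.mod_self])),
        hf (k := l.length - 1) (by omega) (by omega)]
      rwa [List.getLast_eq_getElem, List.head_eq_getElem] at hclosed
  obtain ⟨v, hv, w, hw, hvw, hna⟩ := hna
  obtain ⟨i, rfl⟩ : v ∈ Set.range f := hrange ▸ hv
  obtain ⟨j, rfl⟩ : w ∈ Set.range f := hrange ▸ hw
  rw [← hrange]
  exact flexible_range_of_cycle hΔ f hadj heven ⟨i, j, fun h => hvw (congrArg f h), hna⟩

end Flexible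

/-! ### Growth of balls without flexible sets -/

/-- The set of nodes at distance exactly `r` from `o`. -/
def sphere {V : Type*} (G : SimpleGraph V) (o : V) (r : ℕ) : Set V :=
  {w | G.edist o w = r}

/-- The list `m` is the interior of a path of even length from `a` to `b` that stays at distance
less than `r` from `o`. -/
structure IsCap {V : Type*} (G : SimpleGraph V) (o : V) (r : ℕ) (a b : V) (m : List V) :
    Prop where
  isChain : (a :: (m ++ [b])).IsChain G.Adj
  nodup : m.Nodup
  below : ∀ x ∈ m, ∃ s < r, x ∈ sphere G o s
  odd : Odd m.length

section Sphere

variable {V : Type*} {G : SimpleGraph V} {o v w : V} {r s : ℕ}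

theorem mem_sphere_unique (h : v ∈ sphere G o r) (h' : v ∈ sphere G o s) : r = s := by
  exact_mod_cast (show G.edist o v = r from h).symm.trans h'

theorem near_of_mem_sphere (h : v ∈ sphere G o r) : Near G r o v :=
  le_of_eq h

theorem exists_mem_sphere_of_near (h : Near G r o v) : ∃ s ≤ r, v ∈ sphere G o s := by
  obtain ⟨s, hs⟩ := ENat.ne_top_iff_exists.1 (ne_top_of_le_ne_top (ENat.natCast_ne_top r) h)
  rw [Near, ← hs] at h
  exact ⟨s, by exact_mod_cast h, hs.symm⟩

theorem le_of_mem_sphere_of_near (h : v ∈ sphere G o s) (h' : Near G r o v) : s ≤ r := by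
  rw [Near, show G.edist o v = s from h] at h'
  exact_mod_cast h'

theorem mem_sphere_zero_iff : v ∈ sphere G o 0 ↔ v = o := by
  rw [sphere, Set.mem_ofPred_eq, Nat.cast_zero, SimpleGraph.edist_eq_zero_iff, eq_comm]

theorem mem_sphere_one_of_adj (h : G.Adj o v) : v ∈ sphere G o 1 := by
  rw [sphere, Set.mem_ofPred_eq, Nat.cast_one, SimpleGraph.edist_eq_one_iff_adj]
  exact h

theorem ne_of_mem_sphere (h : v ∈ sphere G o r) (h' : w ∈ sphere G o s) (hrs : r ≠ s) : v ≠ w := by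
  rintro rfl
  exact hrs (mem_sphere_unique h h')

theorem le_succ_of_adj_of_mem_sphere (h : v ∈ sphere G o r) (hvw : G.Adj v w)
    (h' : w ∈ sphere G o s) : s ≤ r + 1 :=
  le_of_mem_sphere_of_near h' ((near_of_mem_sphere h).snoc hvw)

theorem not_adj_of_mem_sphere (h : v ∈ sphere G o r) (h' : w ∈ sphere G o s) (hrs : r + 2 ≤ s) :
    ¬ G.Adj v w := fun hvw => by
  have := le_succ_of_adj_of_mem_sphere h hvw h'
  omega

theorem exists_mem_sphere_of_adj (h : v ∈ sphere G o r) (hvw : G.Adj v w) :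
    ∃ s, w ∈ sphere G o s ∧ s ≤ r + 1 ∧ r ≤ s + 1 := by
  obtain ⟨s, hs, hw⟩ := exists_mem_sphere_of_near ((near_of_mem_sphere h).snoc hvw)
  exact ⟨s, hw, hs, le_succ_of_adj_of_mem_sphere hw hvw.symm h⟩

theorem exists_parent (h : w ∈ sphere G o (r + 1)) : ∃ p, G.Adj p w ∧ p ∈ sphere G o r := by
  obtain h' | ⟨p, hp, hpw⟩ := near_succ_iff'.1 (near_of_mem_sphere h)
  · exact absurd (le_of_mem_sphere_of_near h h') (by omega)
  · obtain ⟨s, hs, hps⟩ := exists_mem_sphere_of_near hp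
    have := le_succ_of_adj_of_mem_sphere hps hpw h
    obtain rfl : s = r := by omega
    exact ⟨p, hpw, hps⟩

namespace IsCap

variable {a b p q : V} {m : List V}

theorem ne_nil (hm : IsCap G o r a b m) : m ≠ [] := by
  rintro rfl
  exact Nat.not_odd_zero hm.odd

theorem notMem (hm : IsCap G o r a b m) (hv : v ∈ sphere G o s) (hrs : r ≤ s) : v ∉ m := by
  intro hvm
  obtain ⟨t, ht, hvt⟩ := hm.below v hvm
  exact absurd (mem_sphere_unique hv hvt) (by omega)

theorem singleton (hp : p ∈ sphere G o r) (hpa : G.Adj p a) (hpb : G.Adj p b) :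
    IsCap G o (r + 1) a b [p] where
  isChain := by simp [hpa.symm, hpb]
  nodup := List.nodup_singleton p
  below := by simpa using ⟨r, le_rfl, hp⟩
  odd := odd_one

theorem extend (hm : IsCap G o r p q m) (hp : p ∈ sphere G o r) (hq : q ∈ sphere G o r)
    (hpq : p ≠ q) (hpa : G.Adj p a) (hqb : G.Adj q b) :
    IsCap G o (r + 1) a b (p :: (m ++ [q])) where
  isChain := by
    rw [List.cons_append, List.append_assoc, List.singleton_append]
    exact List.isChain_cons_cons.2 ⟨hpa.symm,
      List.isChain_cons_append_cons_cons.2 ⟨hm.isChain, hqb, List.isChain_singleton b⟩⟩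
  nodup := by
    rw [List.nodup_cons, List.mem_append, List.mem_singleton, not_or, ← List.concat_eq_append,
      List.nodup_concat]
    exact ⟨⟨hm.notMem hp le_rfl, hpq⟩, hm.notMem hq le_rfl, hm.nodup⟩
  below x hx := by
    simp only [List.mem_cons, List.mem_append, List.not_mem_nil, or_false] at hx
    rcases hx with rfl | hx | rfl
    · exact ⟨r, r.lt_succ_self, hp⟩
    · obtain ⟨s, hs, hxs⟩ := hm.below x hx
      exact ⟨s, by omega, hxs⟩
    · exact ⟨r, r.lt_succ_self, hq⟩
  odd := by
    rw [List.length_cons, List.length_append, List.length_singleton]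
    exact hm.odd.add_one.add_one

end IsCap

theorem exists_isCap {a b : V} (ha : a ∈ sphere G o r) (hb : b ∈ sphere G o r) (hab : a ≠ b) :
    ∃ m, IsCap G o r a b m ∧
      ((∃ q, m = [q]) ∨ ∃ q ∈ m, ∃ s, s + 2 ≤ r ∧ q ∈ sphere G o s) := by
  induction r generalizing a b with
  | zero =>
    rw [mem_sphere_zero_iff] at ha hb
    exact absurd (ha.trans hb.symm) hab
  | succ r ih =>
    obtain ⟨p, hpa, hp⟩ := exists_parent ha
    obtain ⟨q, hqb, hq⟩ := exists_parent hb
    by_cases hpq : p = q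
    · subst hpq
      exact ⟨[p], .singleton hp hpa hqb, Or.inl ⟨p, rfl⟩⟩
    · obtain ⟨m, hm, -⟩ := ih hp hq hpq
      obtain ⟨x, hx⟩ := List.exists_mem_of_ne_nil m hm.ne_nil
      obtain ⟨s, hs, hxs⟩ := hm.below x hx
      exact ⟨p :: (m ++ [q]), hm.extend hp hq hpq hpa hqb,
        Or.inr ⟨x, by simp [hx], s, by omega, hxs⟩⟩

end Sphere

/-- The maximum degree of `G` is at most `Δ ≥ 3`, no `Δ + 1` nodes form a clique, and no nonempty
flexible set lies in the ball of radius `g` around `o`. -/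
structure Rigid {V : Type*} (Δ : ℕ) (G : SimpleGraph V) (o : V) (g : ℕ) : Prop where
  degree_le : ∀ v, (G.neighborSet v).ncard ≤ Δ
  three_le : 3 ≤ Δ
  cliqueFree : G.CliqueFree (Δ + 1)
  not_flexible : ∀ F : Set V, F.Nonempty → (∀ x ∈ F, Near G g o x) → ¬ Flexible Δ G F

/-- The nodes two steps further away from `o` than `v` that are reached from `v` in two steps. -/
def grandchildren {V : Type*} (G : SimpleGraph V) (o : V) (r : ℕ) (v : V) : Set V :=
  {x ∈ sphere G o (r + 2) | ∃ w ∈ sphere G o (r + 1), G.Adj v w ∧ G.Adj w x}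

theorem ncard_mul_le_ncard {ι α : Type*} [Finite ι] [Finite α] {A : Set ι} {B : Set α} {m : ℕ}
    (S : ι → Set α) (hSB : ∀ i ∈ A, S i ⊆ B) (hm : ∀ i ∈ A, m ≤ (S i).ncard)
    (hd : A.PairwiseDisjoint S) : A.ncard * m ≤ B.ncard := by
  calc A.ncard * m = ∑ _ ∈ A.toFinite.toFinset, m := by
        rw [Finset.sum_const, smul_eq_mul, Set.ncard_eq_toFinset_card A]
    _ ≤ ∑ i ∈ A.toFinite.toFinset, (S i).ncard :=
        Finset.sum_le_sum fun i hi => hm i (A.toFinite.mem_toFinset.1 hi)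
    _ = (⋃ i ∈ A, S i).ncard := by
        rw [A.toFinite.ncard_biUnion (fun i _ => (S i).toFinite) hd,
          finsum_mem_eq_finite_toFinset_sum]
    _ ≤ B.ncard := Set.ncard_le_ncard (Set.iUnion₂_subset hSB)

namespace Rigid

variable {V : Type*} [Finite V] {Δ : ℕ} {G : SimpleGraph V} {o : V} {g r : ℕ}

theorem false_of_chain (h : Rigid Δ G o g) {l : List V} (hnd : l.Nodup) (hch : l.IsChain G.Adj)
    (hne : l ≠ []) (hclosed : G.Adj (l.getLast hne) (l.head hne)) (heven : Even l.length)
    (hna : ∃ x ∈ l, ∃ y ∈ l, x ≠ y ∧ ¬ G.Adj x y) (hnear : ∀ x ∈ l, Near G g o x) : False :=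
  h.not_flexible {v | v ∈ l} (List.exists_mem_of_ne_nil l hne) hnear
    (flexible_of_chain h.degree_le hnd hch hne hclosed heven hna)

theorem ncard_neighborSet (h : Rigid Δ G o g) {v : V} (hv : Near G g o v) :
    (G.neighborSet v).ncard = Δ := by
  refine (h.degree_le v).antisymm (not_lt.1 fun hlt => ?_)
  exact h.not_flexible {v} (Set.singleton_nonempty v) (by simpa using hv) (flexible_singleton hlt)

/-- A cap and a path `l` outside of it form an even cycle. -/
theorem false_of_isCap (h : Rigid Δ G o g) (hr : r ≤ g) {a b : V} {m l : List V}
    (ha : a ∈ sphere G o r) (hb : b ∈ sphere G o r) (hm : IsCap G o r a b m)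
    (hch : (b :: (l ++ [a])).IsChain G.Adj) (hnd : (b :: (l ++ [a])).Nodup) (hodd : Odd l.length)
    (hlevel : ∀ x ∈ l, ∃ s, r ≤ s ∧ s ≤ g ∧ x ∈ sphere G o s)
    (hna : ∃ x ∈ a :: m ++ b :: l, ∃ y ∈ a :: m ++ b :: l, x ≠ y ∧ ¬ G.Adj x y) : False := by
  rw [← List.cons_append, List.isChain_append] at hch
  have hne : a :: m ++ b :: l ≠ [] := by simp
  refine h.false_of_chain (l := a :: m ++ b :: l) ?_ ?_ hne ?_ ?_ hna ?_
  · have hlm : ∀ x ∈ l, x ∉ m := fun x hx => by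
      obtain ⟨s, hs, -, hxs⟩ := hlevel x hx
      exact hm.notMem hxs hs
    simp only [List.nodup_cons, List.mem_append, List.mem_singleton, not_or, List.nodup_append]
      at hnd
    simp only [List.cons_append, List.nodup_cons, List.nodup_append, List.mem_append,
      List.mem_cons, not_or, forall_eq_or_imp]
    exact ⟨⟨hm.notMem ha le_rfl, Ne.symm hnd.1.2, fun hal => hnd.2.2.2 a hal a rfl rfl⟩, hm.nodup,
      ⟨hnd.1.1, hnd.2.1⟩, fun x hx => ⟨fun hxb => hm.notMem hb le_rfl (hxb ▸ hx),
        fun y hy hxy => hlm y hy (hxy ▸ hx)⟩⟩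
  · exact List.isChain_split.2 ⟨hm.isChain, hch.1⟩
  · rw [List.getLast_append_of_ne_nil _ (List.cons_ne_nil b l)]
    exact hch.2.2 _ (List.getLast_mem_getLast? _) a rfl
  · rw [List.length_append, List.length_cons, List.length_cons]
    exact hm.odd.add_one.add hodd.add_one
  · intro x hx
    simp only [List.cons_append, List.mem_cons, List.mem_append] at hx
    rcases hx with rfl | hx | rfl | hx
    · exact (near_of_mem_sphere ha).mono hr
    · obtain ⟨s, hs, hxs⟩ := hm.below x hx
      exact (near_of_mem_sphere hxs).mono (by omega)
    · exact (near_of_mem_sphere hb).mono hr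
    · obtain ⟨s, -, hs, hxs⟩ := hlevel x hx
      exact (near_of_mem_sphere hxs).mono hs

theorem parent_unique (h : Rigid Δ G o g) (hr : r + 1 ≤ g) {p q v : V}
    (hv : v ∈ sphere G o (r + 1)) (hp : p ∈ sphere G o r) (hq : q ∈ sphere G o r)
    (hpv : G.Adj p v) (hqv : G.Adj q v) : p = q := by
  by_contra hpq
  obtain ⟨m, hm, -⟩ := exists_isCap hp hq hpq
  obtain ⟨x, hx⟩ := List.exists_mem_of_ne_nil m hm.ne_nil
  obtain ⟨s, hs, hxs⟩ := hm.below x hx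
  exact h.false_of_isCap (l := [v]) (by omega) hp hq hm (by simp [hqv, hpv.symm])
    (by simp [hqv.ne, hpv.ne.symm, Ne.symm hpq]) odd_one
    (by simpa using ⟨r + 1, by omega, hr, hv⟩)
    ⟨x, by simp [hx], v, by simp, ne_of_mem_sphere hxs hv (by omega),
      not_adj_of_mem_sphere hxs hv (by omega)⟩

theorem adj_of_siblings (h : Rigid Δ G o g) (hr : r + 1 ≤ g) {v a b p : V}
    (hv : v ∈ sphere G o (r + 1)) (ha : a ∈ sphere G o (r + 1)) (hb : b ∈ sphere G o (r + 1))
    (hva : G.Adj v a) (hvb : G.Adj v b) (hab : a ≠ b) (hp : p ∈ sphere G o r) (hpa : G.Adj p a) :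
    G.Adj a b ∧ G.Adj p v := by
  by_contra hcon
  obtain ⟨m, hm, hshape⟩ := exists_isCap ha hb hab
  refine h.false_of_isCap (l := [v]) hr ha hb hm (by simp [hva, hvb.symm])
    (by simp [hva.ne, hvb.ne.symm, hab.symm]) odd_one
    (by simpa using ⟨r + 1, r.lt_succ_self, hr, hv⟩) ?_
  rcases hshape with ⟨q, rfl⟩ | ⟨q, hq, s, hs, hqs⟩
  · have hqa : G.Adj q a := (List.isChain_cons_cons.1 hm.isChain).1.symm
    obtain ⟨s, hs, hqs⟩ := hm.below q (List.mem_singleton_self q)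
    have := le_succ_of_adj_of_mem_sphere hqs hqa ha
    obtain rfl : s = r := by omega
    obtain rfl := h.parent_unique hr ha hp hqs hpa hqa
    rcases not_and_or.1 hcon with hadj | hadj
    · exact ⟨a, by simp, b, by simp, hab, hadj⟩
    · exact ⟨p, by simp, v, by simp, ne_of_mem_sphere hp hv (by omega), hadj⟩
  · exact ⟨q, by simp [hq], a, by simp, ne_of_mem_sphere hqs ha (by omega),
      not_adj_of_mem_sphere hqs ha hs⟩

theorem adj_of_cousins (h : Rigid Δ G o g) (hr : r + 1 ≤ g) {v v' w w' : V}
    (hv : v ∈ sphere G o r) (hv' : v' ∈ sphere G o r) (hvv' : G.Adj v v')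
    (hw : w ∈ sphere G o (r + 1)) (hw' : w' ∈ sphere G o (r + 1)) (hvw : G.Adj v w)
    (hww' : G.Adj w w') : G.Adj v w' := by
  by_contra hcon
  obtain ⟨p, hpw', hp⟩ := exists_parent hw'
  have hne : ∀ {x y}, x ∈ sphere G o r → y ∈ sphere G o (r + 1) → x ≠ y := fun hx hy =>
    ne_of_mem_sphere hx hy (by omega)
  have hpv : p ≠ v := by
    rintro rfl
    exact hcon hpw'
  by_cases hpv' : p = v'
  · subst hpv'
    refine h.false_of_chain (l := [p, v, w, w']) ?_ ?_ (by simp) ?_ ⟨2, rfl⟩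
      ⟨v, by simp, w', by simp, hne hv hw', hcon⟩ ?_
    · simp [hpv, hne hp hw, hne hp hw', hne hv hw, hne hv hw', hww'.ne]
    · simp [hvv'.symm, hvw, hww']
    · exact hpw'.symm
    · simp only [List.mem_cons, List.not_mem_nil, or_false]
      rintro x (rfl | rfl | rfl | rfl)
      · exact (near_of_mem_sphere hp).mono (by omega)
      · exact (near_of_mem_sphere hv).mono (by omega)
      · exact (near_of_mem_sphere hw).mono hr
      · exact (near_of_mem_sphere hw').mono hr
  · obtain ⟨m, hm, -⟩ := exists_isCap hv' hp (Ne.symm hpv')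
    refine h.false_of_isCap (l := [w', w, v]) (by omega) hv' hp hm ?_ ?_ ⟨1, rfl⟩ ?_
      ⟨v, by simp, w', by simp, hne hv hw', hcon⟩
    · simp [hpw', hww'.symm, hvw.symm, hvv']
    · simp [hne hp hw, hne hp hw', hpv, hpv', hww'.ne.symm, (hne hv hw').symm, (hne hv' hw').symm,
        (hne hv hw).symm, (hne hv' hw).symm, hvv'.ne]
    · simpa using ⟨⟨r + 1, by omega, hr, hw'⟩, ⟨r + 1, by omega, hr, hw⟩, r, le_rfl, by omega, hv⟩

theorem degIn_sphere_one (h : Rigid Δ G o g) : degIn G (sphere G o 1) o = Δ := by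
  have hsub : G.neighborSet o ⊆ sphere G o 1 := fun _ hw => mem_sphere_one_of_adj hw
  rw [degIn, Set.inter_eq_left.2 hsub, h.ncard_neighborSet (Near.refl o)]

theorem one_add_degIn_add_degIn (h : Rigid Δ G o g) (hr : r + 1 ≤ g) {v : V}
    (hv : v ∈ sphere G o (r + 1)) :
    1 + degIn G (sphere G o (r + 1)) v + degIn G (sphere G o (r + 2)) v = Δ := by
  obtain ⟨p, hpv, hp⟩ := exists_parent hv
  have hparent : G.neighborSet v ∩ sphere G o r = {p} := by
    ext w
    constructor
    · exact fun ⟨hvw, hw⟩ => h.parent_unique hr hv hw hp hvw.symm hpv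
    · rintro rfl
      exact ⟨hpv.symm, hp⟩
  have hdisj {s t : ℕ} (hst : s ≠ t) :
      Disjoint (G.neighborSet v ∩ sphere G o s) (G.neighborSet v ∩ sphere G o t) :=
    Set.disjoint_left.2 fun x hx hx' => hst (mem_sphere_unique hx.2 hx'.2)
  have hunion : G.neighborSet v = G.neighborSet v ∩ sphere G o r ∪
      G.neighborSet v ∩ sphere G o (r + 1) ∪ G.neighborSet v ∩ sphere G o (r + 2) := by
    simp only [← Set.inter_union_distrib_left]
    refine (Set.inter_eq_left.2 fun w hvw => ?_).symm
    obtain ⟨s, hs, h1, h2⟩ := exists_mem_sphere_of_adj hv hvw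
    obtain rfl | rfl | rfl : s = r ∨ s = r + 1 ∨ s = r + 2 := by omega
    · exact Or.inl (Or.inl hs)
    · exact Or.inl (Or.inr hs)
    · exact Or.inr hs
  rw [← h.ncard_neighborSet ((near_of_mem_sphere hv).mono hr), hunion,
    Set.ncard_union_eq (Set.disjoint_union_left.2 ⟨hdisj (by omega), hdisj (by omega)⟩),
    Set.ncard_union_eq (hdisj (by omega)), hparent, Set.ncard_singleton]
  rfl

/-- Otherwise `v`, its parent and its neighbours at the same distance from `o` form a clique. -/
theorem one_le_degIn (h : Rigid Δ G o g) (hr : r + 1 ≤ g) {v : V} (hv : v ∈ sphere G o (r + 1)) :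
    1 ≤ degIn G (sphere G o (r + 2)) v := by
  by_contra hcon
  have hcard : 1 + degIn G (sphere G o (r + 1)) v + degIn G (sphere G o (r + 2)) v = Δ :=
    h.one_add_degIn_add_degIn hr hv
  have hΔ := h.three_le
  obtain ⟨p, hpv, hp⟩ := exists_parent hv
  rw [degIn] at hcard
  set S := G.neighborSet v ∩ sphere G o (r + 1) with hS
  have hpair : S.Pairwise G.Adj := fun a ha b hb hab => by
    obtain ⟨q, hqa, hq⟩ := exists_parent ha.2
    exact (h.adj_of_siblings hr hv ha.2 hb.2 ha.1 hb.1 hab hq hqa).1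
  have hparent : ∀ a ∈ S, G.Adj p a := fun a ha => by
    obtain ⟨b, hb, hba⟩ := Set.exists_ne_of_one_lt_ncard (s := S) (by omega) a
    obtain ⟨q, hqa, hq⟩ := exists_parent ha.2
    have hqv := (h.adj_of_siblings hr hv ha.2 hb.2 ha.1 hb.1 hba.symm hq hqa).2
    rwa [h.parent_unique hr hv hp hq hpv hqv]
  have hvS : v ∉ S := fun hv => G.irrefl hv.1
  have hpS : p ∉ insert v S := by
    rintro (rfl | hpS)
    · exact G.irrefl hpv
    · exact absurd (mem_sphere_unique hp hpS.2) (by omega)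
  have hclique : G.IsClique (insert p (insert v S)) := by
    rw [SimpleGraph.isClique_insert, SimpleGraph.isClique_insert]
    refine ⟨⟨hpair, fun a ha _ => ha.1⟩, ?_⟩
    rintro a (rfl | ha) -
    exacts [hpv, hparent a ha]
  refine h.cliqueFree (Set.toFinite (insert p (insert v S))).toFinset ⟨by simpa using hclique, ?_⟩
  rw [← Set.ncard_eq_toFinset_card, Set.ncard_insert_of_notMem hpS, Set.ncard_insert_of_notMem hvS]
  omega

theorem degIn_mul_le_ncard_grandchildren (h : Rigid Δ G o g) (hr : r + 2 ≤ g) {v : V} {m : ℕ}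
    (hm : ∀ w ∈ sphere G o (r + 1), G.Adj v w → m ≤ degIn G (sphere G o (r + 2)) w) :
    degIn G (sphere G o (r + 1)) v * m ≤ (grandchildren G o r v).ncard := by
  refine ncard_mul_le_ncard (fun w => G.neighborSet w ∩ sphere G o (r + 2))
    (fun w hw x hx => ⟨hx.2, w, hw.2, hw.1, hx.1⟩) (fun w hw => hm w hw.2 hw.1) ?_
  intro w hw w' hw' hne
  exact Set.disjoint_left.2 fun x hx hx' =>
    hne (h.parent_unique hr hx.2 hw.2 hw'.2 hx.1 hx'.1)

theorem le_degIn_children_of_adj (h : Rigid Δ G o g) (hr : r + 2 ≤ g) {v v' w : V}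
    (hv : v ∈ sphere G o (r + 1)) (hv' : v' ∈ sphere G o (r + 1)) (hvv' : G.Adj v v')
    (hw : w ∈ sphere G o (r + 2)) (hvw : G.Adj v w) :
    Δ - degIn G (sphere G o (r + 2)) v ≤ degIn G (sphere G o (r + 3)) w := by
  have hcard : 1 + degIn G (sphere G o (r + 2)) w + degIn G (sphere G o (r + 3)) w = Δ :=
    h.one_add_degIn_add_degIn hr hw
  have hsub : G.neighborSet w ∩ sphere G o (r + 2) ⊆
      (G.neighborSet v ∩ sphere G o (r + 2)) \ {w} := fun w' hw' =>
    ⟨⟨h.adj_of_cousins hr hv hv' hvv' hw hw'.2 hvw hw'.1, hw'.2⟩, fun he => hw'.1.ne he.symm⟩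
  have hle : degIn G (sphere G o (r + 2)) w < degIn G (sphere G o (r + 2)) v :=
    (Set.ncard_le_ncard hsub).trans_lt (Set.ncard_sdiff_singleton_lt_of_mem ⟨hvw, hw⟩)
  omega

theorem le_ncard_grandchildren (h : Rigid Δ G o g) (hr : r + 2 ≤ g) {v : V}
    (hv : v ∈ sphere G o r) : Δ - 1 ≤ (grandchildren G o r v).ncard := by
  have hchildren : degIn G (sphere G o (r + 1)) v ≤ (grandchildren G o r v).ncard := by
    simpa using h.degIn_mul_le_ncard_grandchildren hr
      fun w hw _ => h.one_le_degIn (by omega) hw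
  rcases r with _ | r
  · rw [mem_sphere_zero_iff] at hv
    subst hv
    rw [zero_add, h.degIn_sphere_one] at hchildren
    omega
  have hcard := h.one_add_degIn_add_degIn (by omega) hv
  rcases (G.neighborSet v ∩ sphere G o (r + 1)).eq_empty_or_nonempty with hS | ⟨v', hvv', hv'⟩
  · rw [degIn, hS, Set.ncard_empty, add_zero] at hcard
    exact (Nat.sub_le_iff_le_add'.2 hcard.ge).trans hchildren
  · have hpos := h.one_le_degIn (by omega) hv
    have hsame : 0 < degIn G (sphere G o (r + 1)) v := (Set.ncard_pos).2 ⟨v', hvv', hv'⟩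
    refine le_trans ?_ (h.degIn_mul_le_ncard_grandchildren hr fun w hw hvw =>
      h.le_degIn_children_of_adj (by omega) hv hv' hvv' hw hvw)
    change Δ - 1 ≤ degIn G (sphere G o (r + 2)) v * (Δ - degIn G (sphere G o (r + 2)) v)
    obtain ⟨k, hk⟩ := Nat.exists_eq_add_of_le' hpos
    obtain ⟨d, hd⟩ : ∃ d, Δ = k + 1 + (d + 1) := ⟨Δ - (k + 2), by omega⟩
    rw [hk, hd, Nat.add_sub_cancel_left]
    have : (k + 1) * (d + 1) = k * d + (k + d + 1) := by ring
    omega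

theorem mul_ncard_sphere_le (h : Rigid Δ G o g) (hr : r + 2 ≤ g) :
    (sphere G o r).ncard * (Δ - 1) ≤ (sphere G o (r + 2)).ncard := by
  refine ncard_mul_le_ncard (grandchildren G o r) (fun _ _ x hx => hx.1)
    (fun v hv => h.le_ncard_grandchildren hr hv) fun v hv v' hv' hne => Set.disjoint_left.2 ?_
  rintro x ⟨hx, w, hw, hvw, hwx⟩ ⟨-, w', hw', hvw', hwx'⟩
  obtain rfl := h.parent_unique hr hx hw hw' hwx hwx'
  exact hne (h.parent_unique (by omega) hw hv hv' hvw hvw')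

theorem pow_le_ncard_sphere (h : Rigid Δ G o g) {k : ℕ} (hk : 2 * k ≤ g) :
    (Δ - 1) ^ k ≤ (sphere G o (2 * k)).ncard := by
  induction k with
  | zero =>
    rw [pow_zero]
    exact Nat.one_le_iff_ne_zero.2 (Set.ncard_ne_zero_of_mem (mem_sphere_zero_iff.2 rfl))
  | succ k ih =>
    rw [pow_succ]
    exact (Nat.mul_le_mul_right _ (ih (by omega))).trans (h.mul_ncard_sphere_le (by omega))

theorem pow_le_ncard_ball (h : Rigid Δ G o g) {k : ℕ} (hk : 2 * k ≤ g) :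
    (Δ - 1) ^ k ≤ {w | Near G g o w}.ncard :=
  (h.pow_le_ncard_sphere hk).trans
    (Set.ncard_le_ncard fun _ hx => (near_of_mem_sphere hx).mono hk)

end Rigid

theorem ncard_ball_le {V : Type*} [Finite V] {Δ : ℕ} {G : SimpleGraph V}
    (hΔ : ∀ v, (G.neighborSet v).ncard ≤ Δ) (r : ℕ) (v : V) :
    {w | Near G r v w}.ncard ≤ (Δ + 1) ^ r := by
  induction r generalizing v with
  | zero => simp [near_zero_iff]
  | succ r ih =>
    let N := (Set.toFinite (insert v (G.neighborSet v))).toFinset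
    have hsub : {w | Near G (r + 1) v w} ⊆ ⋃ u ∈ N, {w | Near G r u w} := fun w hw => by
      rw [Set.mem_iUnion₂]
      rcases near_succ_iff.1 hw with hw | ⟨u, hvu, hw⟩
      · exact ⟨v, by simp [N], hw⟩
      · exact ⟨u, by simp [N, hvu], hw⟩
    calc {w | Near G (r + 1) v w}.ncard
        ≤ ∑ u ∈ N, {w | Near G r u w}.ncard :=
          (Set.ncard_le_ncard hsub).trans (N.set_ncard_biUnion_le _)
      _ ≤ N.card * (Δ + 1) ^ r := Finset.sum_le_card_nsmul _ _ _ fun u _ => ih u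
      _ ≤ (Δ + 1) ^ (r + 1) := by
          rw [pow_succ']
          refine Nat.mul_le_mul_right _ ?_
          rw [← Set.ncard_eq_toFinset_card]
          exact (Set.ncard_insert_le _ _).trans (Nat.succ_le_succ (hΔ v))

/-! ### Ruling sets -/

section Ruling

variable {V : Type*} {G : SimpleGraph V} {α : ℕ} {h : V → ℕ} {C : Set V} {j : ℕ} {w w' : V}

/-- The nodes of `C` whose label differs from those of all other nodes of `C` at distance at most
`α`. -/
def candidates (α : ℕ) (h : V → ℕ) (G : SimpleGraph V) (C : Set V) : Set V :=
  {w ∈ C | ∀ w' ∈ C, Near G α w w' → w' ≠ w → h w' ≠ h w}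

/-- A ruling set of the candidates, computed bit by bit: in step `j`, among the nodes whose labels
agree but for the last `j + 1` bits, those with bit `j` set give way to those at distance at most
`α` with bit `j` not set. -/
def ruling (α : ℕ) (h : V → ℕ) (G : SimpleGraph V) (C : Set V) : ℕ → Set V
  | 0 => candidates α h G C
  | j + 1 => {w ∈ ruling α h G C j | h w / 2 ^ j % 2 = 1 → ∀ w' ∈ ruling α h G C j, Near G α w w' →
      h w' / 2 ^ j % 2 = 0 → h w' / 2 ^ j / 2 ≠ h w / 2 ^ j / 2}

theorem ruling_subset_candidates : ruling α h G C j ⊆ candidates α h G C := by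
  induction j with
  | zero => exact subset_rfl
  | succ j ih => exact fun w hw => ih hw.1

theorem ruling_subset : ruling α h G C j ⊆ C :=
  fun _ hw => (ruling_subset_candidates hw).1

theorem div_two_pow_ne_of_mem_ruling (hw : w ∈ ruling α h G C j) (hw' : w' ∈ ruling α h G C j)
    (hne : w ≠ w') (hn : Near G α w w') : h w / 2 ^ j ≠ h w' / 2 ^ j := by
  induction j with
  | zero =>
    simp only [pow_zero, Nat.div_one]
    exact fun e => hw.2 w' hw'.1 hn hne.symm e.symm
  | succ j ih =>
    have hdiv := ih hw.1 hw'.1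
    rw [pow_succ, ← Nat.div_div_eq_div_mul, ← Nat.div_div_eq_div_mul]
    intro e
    rcases Nat.mod_two_eq_zero_or_one (h w / 2 ^ j) with hb | hb <;>
      rcases Nat.mod_two_eq_zero_or_one (h w' / 2 ^ j) with hb' | hb'
    · omega
    · exact hw'.2 hb' w hw.1 hn.symm hb e
    · exact hw.2 hb w' hw'.1 hn hb' e.symm
    · omega

theorem eq_of_mem_ruling_of_near (hh : ∀ v, h v < 2 ^ j) (hw : w ∈ ruling α h G C j)
    (hw' : w' ∈ ruling α h G C j) (hn : Near G α w w') : w = w' := by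
  by_contra hne
  refine div_two_pow_ne_of_mem_ruling hw hw' hne hn ?_
  rw [Nat.div_eq_of_lt (hh w), Nat.div_eq_of_lt (hh w')]

theorem exists_mem_ruling_near (hw : w ∈ candidates α h G C) (j : ℕ) :
    ∃ w' ∈ ruling α h G C j, Near G (j * α) w w' := by
  induction j with
  | zero => exact ⟨w, hw, Near.refl w⟩
  | succ j ih =>
    obtain ⟨w', hw', hn⟩ := ih
    rw [Nat.succ_mul]
    by_cases hmem : w' ∈ ruling α h G C (j + 1)
    · exact ⟨w', hmem, hn.mono (Nat.le_add_right _ _)⟩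
    · have hgive : ¬ (h w' / 2 ^ j % 2 = 1 → ∀ w'' ∈ ruling α h G C j, Near G α w' w'' →
          h w'' / 2 ^ j % 2 = 0 → h w'' / 2 ^ j / 2 ≠ h w' / 2 ^ j / 2) := fun hc => hmem ⟨hw', hc⟩
      push Not at hgive
      obtain ⟨_, w'', hw'', hn', hb, _⟩ := hgive
      exact ⟨w'', ⟨hw'', fun hb' => by omega⟩, hn.trans hn'⟩

theorem isLocal_mem_ruling {C : SimpleGraph V → Set V} {s : ℕ}
    (hC : IsLocal s fun G w => w ∈ C G) (j : ℕ) :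
    IsLocal (s + (j + 1) * α) fun G w => w ∈ ruling α h G (C G) j := by
  induction j with
  | zero =>
    rw [zero_add, one_mul, Nat.add_comm]
    intro G G' w hG
    simp only [ruling, candidates, Set.mem_ofPred_eq, eq_iff_iff,
      hC.eq_of_near hG (Near.refl w)]
    refine and_congr_right fun _ => forall_congr' fun w' => ?_
    rw [← (hG.mono (Nat.le_add_right α s)).near_iff, imp.swap, imp.swap (a := w' ∈ C G')]
    exact imp_congr_right fun hw' => by rw [hC.eq_of_near hG hw']
  | succ j ih =>
    rw [add_mul (j + 1), one_mul, ← add_assoc, Nat.add_comm]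
    intro G G' w hG
    simp only [ruling, Set.mem_ofPred_eq, eq_iff_iff, ih.eq_of_near hG (Near.refl w)]
    refine and_congr_right fun _ => imp_congr_right fun _ => forall_congr' fun w' => ?_
    rw [← (hG.mono (Nat.le_add_right α _)).near_iff, imp.swap,
      imp.swap (a := w' ∈ ruling α h G' (C G') j)]
    exact imp_congr_right fun hw' => by rw [ih.eq_of_near hG hw']

end Ruling

/-! ### Layers and colour trials -/

section Trials

variable {V : Type*} {G : SimpleGraph V} {B : Set V} {l s : ℕ} {v : V}

/-- The node `v` is at distance at most `l` from the set `B`. -/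
def Within (G : SimpleGraph V) (l : ℕ) (B : Set V) (v : V) : Prop :=
  ∃ z ∈ B, Near G l v z

theorem Within.mono {l' : ℕ} (h : Within G l B v) (hl : l ≤ l') : Within G l' B v := by
  obtain ⟨z, hB, hz⟩ := h
  exact ⟨z, hB, hz.mono hl⟩

theorem Within.exists_adj (h : Within G (l + 1) B v) (h' : ¬ Within G l B v) :
    ∃ u, G.Adj v u ∧ Within G l B u := by
  obtain ⟨z, hB, hz⟩ := h
  obtain hz | ⟨u, hu, hz⟩ := near_succ_iff.1 hz
  · exact absurd ⟨z, hB, hz⟩ h'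
  · exact ⟨u, hu, z, hB, hz⟩

theorem isLocal_within {B : SimpleGraph V → Set V} (hB : IsLocal s fun G v => v ∈ B G) (l : ℕ) :
    IsLocal (l + s) fun G v => Within G l (B G) v := by
  intro G G' v hG
  refine propext (exists_congr fun z => ?_)
  rw [← (hG.mono (Nat.le_add_right l s)).near_iff]
  exact and_congr_left fun hz => by rw [hB.eq_of_near hG hz]

/-- A choice of an element from every nonempty set of colours. -/
abbrev ColorChoice (Δ : ℕ) : Type :=
  (A : {A : Finset (Fin Δ) // A.Nonempty}) → {c : Fin Δ // c ∈ A.1}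

/-- The partial colouring `col` is proper. -/
def IsProper {K : Type*} (G : SimpleGraph V) (col : V → Option K) : Prop :=
  ∀ ⦃v w⦄, G.Adj v w → ∀ ⦃c⦄, col v = some c → col w ≠ some c

variable {Δ : ℕ} {r : V → Bool × ColorChoice Δ} {U : Set V} {col : V → Option (Fin Δ)} {c : Fin Δ}

open Classical in
/-- The colours that do not occur at neighbours of `v`. -/
noncomputable def available (G : SimpleGraph V) (col : V → Option (Fin Δ)) (v : V) :
    Finset (Fin Δ) :=
  {c | ∀ u, G.Adj v u → col u ≠ some c}

theorem mem_available : c ∈ available G col v ↔ ∀ u, G.Adj v u → col u ≠ some c := by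
  simp [available]

open Classical in
/-- The colour that `f` chooses from `A`, if `A` is not empty. -/
noncomputable def ColorChoice.pick (f : ColorChoice Δ) (A : Finset (Fin Δ)) : Option (Fin Δ) :=
  if h : A.Nonempty then some (f ⟨A, h⟩) else none

open Classical in
/-- The colour that `v` tries: an uncoloured node of `U` that is active chooses an available one. -/
noncomputable def attempt (r : V → Bool × ColorChoice Δ) (G : SimpleGraph V) (U : Set V)
    (col : V → Option (Fin Δ)) (v : V) : Option (Fin Δ) :=
  if v ∈ U ∧ col v = none ∧ (r v).1 = true then (r v).2.pick (available G col v) else none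

open Classical in
/-- A step of random colour trials of the nodes of `U`: a node keeps the colour that it tries if no
neighbour tries the same. -/
noncomputable def trial (r : V → Bool × ColorChoice Δ) (G : SimpleGraph V) (U : Set V)
    (col : V → Option (Fin Δ)) (v : V) : Option (Fin Δ) :=
  if attempt r G U col v ≠ none ∧ ∀ u, G.Adj v u → attempt r G U col u ≠ attempt r G U col v then
    attempt r G U col v
  else col v

theorem attempt_eq_some (h : attempt r G U col v = some c) :
    (v ∈ U ∧ col v = none ∧ (r v).1 = true) ∧ c ∈ available G col v := by
  rw [attempt, ColorChoice.pick] at h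
  split_ifs at h with hv hA
  rw [← Option.some.inj h]
  exact ⟨hv, ((r v).2 ⟨_, hA⟩).2⟩

theorem trial_eq_some (h : trial r G U col v = some c) : col v = some c ∨
    attempt r G U col v = some c ∧ ∀ u, G.Adj v u → attempt r G U col u ≠ some c := by
  rw [trial] at h
  split_ifs at h with hv
  · exact Or.inr ⟨h, h ▸ hv.2⟩
  · exact Or.inl h

theorem trial_of_attempt_eq_none (h : attempt r G U col v = none) :
    trial r G U col v = col v := by
  rw [trial, if_neg fun hv => hv.1 h]

theorem trial_of_colored (h : col v ≠ none) : trial r G U col v = col v :=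
  trial_of_attempt_eq_none (if_neg fun hv => h hv.2.1)

theorem trial_of_notMem (h : v ∉ U) : trial r G U col v = col v :=
  trial_of_attempt_eq_none (if_neg fun hv => h hv.1)

theorem IsProper.trial (h : IsProper G col) : IsProper G (trial r G U col) := by
  intro v w hvw c hv hw
  rcases trial_eq_some hv with hv | ⟨hv, hv'⟩ <;> rcases trial_eq_some hw with hw | ⟨hw, -⟩
  · exact h hvw hv hw
  · exact mem_available.1 (attempt_eq_some hw).2 v hvw.symm hv
  · exact mem_available.1 (attempt_eq_some hv).2 w hvw hw
  · exact hv' w hvw hw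

theorem isLocal_available {col : SimpleGraph V → V → Option (Fin Δ)} (hcol : IsLocal s col) :
    IsLocal (1 + s) fun G => available G (col G) := by
  intro G G' v hG
  ext c
  simp only [mem_available, ← hG.adj_iff]
  exact forall₂_congr fun u hu => by rw [hcol.eq_of_near hG (Near.of_adj hu)]

theorem isLocal_attempt {U : SimpleGraph V → Set V} {col : SimpleGraph V → V → Option (Fin Δ)}
    (hU : IsLocal s fun G v => v ∈ U G) (hcol : IsLocal s col) :
    IsLocal (1 + s) fun G => attempt r G (U G) (col G) := by
  intro G G' v hG
  have havail : available G (col G) v = available G' (col G') v := isLocal_available hcol hG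
  have hUv : (v ∈ U G) = (v ∈ U G') := hU.eq_of_near hG (Near.refl v)
  have hcolv : col G v = col G' v := hcol.eq_of_near hG (Near.refl v)
  beta_reduce
  rw [attempt, attempt, havail, hUv, hcolv]

theorem isLocal_trial {U : SimpleGraph V → Set V} {col : SimpleGraph V → V → Option (Fin Δ)}
    (hU : IsLocal s fun G v => v ∈ U G) (hcol : IsLocal s col) :
    IsLocal (s + 2) fun G => trial r G (U G) (col G) := by
  have hatt : IsLocal (1 + s) fun G => attempt r G (U G) (col G) := isLocal_attempt hU hcol
  rw [show s + 2 = 1 + (1 + s) by omega]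
  intro G G' v hG
  have hv : attempt r G (U G) (col G) v = attempt r G' (U G') (col G') v :=
    hatt.eq_of_near hG (Near.refl v)
  beta_reduce
  rw [trial, trial, hv,
    (hcol.mono (Nat.le_add_left s 1)).eq_of_near hG (Near.refl v)]
  congr! 3 with u
  rw [← hG.adj_iff]
  exact imp_congr_right fun hu => by rw [hatt.eq_of_near hG (Near.of_adj hu)]

variable {R K τ : ℕ} {ρ : Fin (R * K) → V → Bool × ColorChoice Δ}

/-- The nodes that try colours in step `τ`: those at distance exactly `R - τ / K` from `B`. The
layers take their turns from the outermost to the innermost, for `K` steps each. -/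
def turn (R K : ℕ) (G : SimpleGraph V) (B : Set V) (τ : ℕ) : Set V :=
  {v | Within G (R - τ / K) B v ∧ ¬ Within G (R - τ / K - 1) B v}

/-- The partial colouring after `τ` steps of colour trials. -/
noncomputable def colorAfter (R K : ℕ) (ρ : Fin (R * K) → V → Bool × ColorChoice Δ)
    (G : SimpleGraph V) (B : Set V) : ℕ → V → Option (Fin Δ)
  | 0 => fun _ => none
  | τ + 1 => if h : τ < R * K then trial (ρ ⟨τ, h⟩) G (turn R K G B τ) (colorAfter R K ρ G B τ)
      else colorAfter R K ρ G B τ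

theorem isProper_colorAfter (τ : ℕ) : IsProper G (colorAfter R K ρ G B τ) := by
  induction τ with
  | zero => exact fun v w _ c h => by simp [colorAfter] at h
  | succ τ ih =>
    rw [colorAfter]
    split_ifs
    · exact ih.trial
    · exact ih

theorem pos_of_colorAfter_ne_none (h : colorAfter R K ρ G B τ v ≠ none) : 0 < τ := by
  rcases τ with _ | τ
  · exact absurd rfl h
  · exact τ.succ_pos

theorem colorAfter_succ_of_colored (h : colorAfter R K ρ G B τ v ≠ none) :
    colorAfter R K ρ G B (τ + 1) v = colorAfter R K ρ G B τ v := by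
  rw [colorAfter]
  split_ifs
  · exact trial_of_colored h
  · rfl

theorem colorAfter_ne_none_mono {τ' : ℕ} (hτ : τ ≤ τ') (h : colorAfter R K ρ G B τ v ≠ none) :
    colorAfter R K ρ G B τ' v ≠ none := by
  induction hτ with
  | refl => exact h
  | step _ ih => rwa [colorAfter_succ_of_colored ih]

theorem not_within_of_colorAfter (h : colorAfter R K ρ G B τ v ≠ none) :
    ∀ l < R - (τ - 1) / K, ¬ Within G l B v := by
  induction τ with
  | zero => exact absurd rfl h
  | succ τ ih =>
    intro l hl
    have hmono : (τ - 1) / K ≤ τ / K := Nat.div_le_div_right (Nat.sub_le τ 1)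
    rw [Nat.add_sub_cancel] at hl
    by_cases hτ : colorAfter R K ρ G B τ v = none
    · by_cases hU : v ∈ turn R K G B τ
      · exact fun hw => hU.2 (hw.mono (by omega))
      · rw [colorAfter] at h
        split_ifs at h
        · exact absurd ((trial_of_notMem hU).trans hτ) h
        · exact absurd hτ h
    · exact ih hτ l (by omega)

theorem isLocal_mem_turn {B : SimpleGraph V → Set V} (hB : IsLocal s fun G v => v ∈ B G) (τ : ℕ) :
    IsLocal (s + R) fun G v => v ∈ turn R K G (B G) τ := by
  have hwithin (l : ℕ) (hl : l ≤ R) : IsLocal (s + R) fun G v => Within G l (B G) v :=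
    (isLocal_within hB l).mono (by omega)
  have hle : R - τ / K ≤ R := Nat.sub_le _ _
  intro G G' v hG
  simp only [turn, Set.mem_ofPred_eq, hwithin _ hle hG,
    hwithin (R - τ / K - 1) ((Nat.sub_le _ _).trans hle) hG]

theorem isLocal_colorAfter {B : SimpleGraph V → Set V} (hB : IsLocal s fun G v => v ∈ B G)
    (τ : ℕ) : IsLocal (s + R + 2 * τ) fun G => colorAfter R K ρ G (B G) τ := by
  induction τ with
  | zero => exact fun _ _ _ _ => rfl
  | succ τ ih =>
    by_cases h : τ < R * K
    · simp only [colorAfter, dif_pos h]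
      exact isLocal_trial ((isLocal_mem_turn hB τ).mono (Nat.le_add_right _ _)) ih
    · simp only [colorAfter, dif_neg h]
      exact ih.mono (by omega)

end Trials

/-! ### The colouring algorithm -/

section Gadgets

variable {V : Type*} {G : SimpleGraph V} {Δ g : ℕ} {v w : V} {F : Set V}

/-- `F` is a nonempty flexible set in the ball of radius `g` around `w`. -/
def IsGadget (Δ g : ℕ) (G : SimpleGraph V) (w : V) (F : Set V) : Prop :=
  (∀ x ∈ F, Near G g w x) ∧ F.Nonempty ∧ Flexible Δ G F

/-- The nodes with a nonempty flexible set in the ball of radius `g` around them. -/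
def centers (Δ g : ℕ) (G : SimpleGraph V) : Set V :=
  {w | ∃ F, IsGadget Δ g G w F}

/-- The flexible set chosen by `w`, which is arbitrary if `w` is not a centre. -/
noncomputable def gadget (Δ g : ℕ) (G : SimpleGraph V) (w : V) : Set V :=
  Classical.epsilon (IsGadget Δ g G w)

/-- A colouring of `F` from the lists `L`, which is arbitrary if there is none. -/
noncomputable def listColoring {K : Type*} [Nonempty K] (G : SimpleGraph V) (F : Set V)
    (L : V → Finset K) : V → K :=
  Classical.epsilon (IsListColoring G F L)

theorem isGadget_gadget (h : w ∈ centers Δ g G) : IsGadget Δ g G w (gadget Δ g G w) :=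
  Classical.epsilon_spec h

theorem isLocal_isGadget : IsLocal g (IsGadget (V := V) Δ g) := by
  intro G G' w hG
  funext F
  refine propext (and_congr (forall₂_congr fun x _ => hG.near_iff) Iff.rfl |>.trans ?_)
  refine and_congr_right fun hF => and_congr_right fun _ => Flexible.congr fun v hv => ?_
  exact hG v (hG.near_iff.2 (hF v hv))

theorem isLocal_mem_centers : IsLocal g fun (G : SimpleGraph V) w => w ∈ centers Δ g G :=
  fun _ _ _ hG => congrArg (fun p : Set V → Prop => ∃ F, p F) (isLocal_isGadget hG)

theorem isLocal_gadget : IsLocal g (gadget (V := V) Δ g) := by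
  intro G G' w hG
  rw [gadget, gadget, isLocal_isGadget hG]

theorem listColoring_gadget_congr {K : Type*} [Nonempty K] {G' : SimpleGraph V}
    {L L' : V → Finset K} (hw : w ∈ centers Δ g G) (hG : AgreeNear g G G' w)
    (hL : ∀ v, Near G g w v → L v = L' v) :
    listColoring G (gadget Δ g G w) L = listColoring G' (gadget Δ g G' w) L' := by
  have hnear : ∀ v ∈ gadget Δ g G' w, Near G g w v := by
    rw [← isLocal_gadget hG]
    exact (isGadget_gadget hw).1
  rw [listColoring, listColoring, isLocal_gadget hG,
    IsListColoring.congr (fun v hv => hL v (hnear v hv)) fun v hv => hG v (hnear v hv)]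

theorem le_card_available_add_degIn [Finite V] (G : SimpleGraph V) (col : V → Option (Fin Δ))
    (v : V) : Δ ≤ (available G col v).card + degIn G {w | col w ≠ none} v := by
  have : Nonempty V := ⟨v⟩
  have hblocked : ∀ c ∈ (available G col v)ᶜ, ∃ u, G.Adj v u ∧ col u = some c := by
    intro c hc
    rw [Finset.mem_compl, mem_available] at hc
    push Not at hc
    exact hc
  choose! u hadj hu using hblocked
  have hle : (((available G col v)ᶜ : Finset (Fin Δ)) : Set (Fin Δ)).ncard ≤
      degIn G {w | col w ≠ none} v := by
    refine Set.ncard_le_ncard_of_injOn u (fun c hc => ⟨hadj c hc, ?_⟩) (fun c hc c' hc' h => ?_)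
      (Set.toFinite _)
    · simp [hu c hc]
    · rw [← Option.some_inj, ← hu c hc, ← hu c' hc', h]
  rw [Set.ncard_coe_finset, Finset.card_compl, Fintype.card_fin] at hle
  omega

theorem isListColoring_listColoring_gadget [Finite V] [NeZero Δ] {col : V → Option (Fin Δ)}
    (hw : w ∈ centers Δ g G) (hcol : ∀ v ∈ gadget Δ g G w, col v = none) :
    IsListColoring G (gadget Δ g G w) (available G col)
      (listColoring G (gadget Δ g G w) (available G col)) := by
  refine Classical.epsilon_spec ((isGadget_gadget hw).2.2 _ fun v _ => ?_)
  refine (le_card_available_add_degIn G col v).trans (Nat.add_le_add_left (degIn_mono ?_ v) _)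
  exact fun x hx hxF => hx (hcol x hxF)

end Gadgets

/-- The parameters of the colouring algorithm. -/
structure Params where
  /-- the number of colours -/
  Δ : ℕ
  /-- the radius of the balls in which flexible sets are searched -/
  g : ℕ
  /-- the number of bits of the labels -/
  b : ℕ
  /-- a node is removed with probability `1 / Q` -/
  Q : ℕ
  /-- the number of colour trials of each node -/
  K : ℕ
  three_le : 3 ≤ Δ
  Q_pos : 0 < Q

namespace Params

variable (P : Params) {V : Type*} {G : SimpleGraph V}

instance : NeZero P.Δ := ⟨by have := P.three_le; omega⟩

instance : NeZero P.Q := ⟨P.Q_pos.ne'⟩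

/-- The distance of the centres in the ruling set. -/
def α : ℕ := 2 * P.g + 1

/-- The number of layers. -/
def R : ℕ := P.b * P.α + P.g

/-- The random choices: labels, removals (a node is removed if its number is `0`), and colour
trials. -/
abbrev Seed (V : Type*) : Type _ :=
  (V → Fin (2 ^ P.b)) × (V → Fin P.Q) × (Fin (P.R * P.K) → V → Bool × ColorChoice P.Δ)

variable (ω : P.Seed V)

/-- The ruling set of centres. -/
def rule (G : SimpleGraph V) : Set V :=
  ruling P.α (fun w => (ω.1 w : ℕ)) G (centers P.Δ P.g G) P.b

/-- The centres in the ruling set whose flexible set contains `v`. There is at most one. -/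
def owners (G : SimpleGraph V) (v : V) : Set V :=
  {s ∈ P.rule ω G | v ∈ gadget P.Δ P.g G s}

/-- The base of the layers: the removed nodes and the flexible sets of the ruling set. -/
def base (G : SimpleGraph V) : Set V :=
  {v | ω.2.1 v = 0 ∨ (P.owners ω G v).Nonempty}

/-- The partial colouring of the layers by colour trials. -/
noncomputable def layered (G : SimpleGraph V) : V → Option (Fin P.Δ) :=
  colorAfter P.R P.K ω.2.2 G (P.base ω G) (P.R * P.K)

/-- The colouring of the flexible set of `s` from the colours that the layers leave. -/
noncomputable def extension (G : SimpleGraph V) (s : V) : V → Fin P.Δ :=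
  listColoring G (gadget P.Δ P.g G s) (available G (P.layered ω G))

open Classical in
/-- The final partial colouring. -/
noncomputable def coloring (G : SimpleGraph V) (v : V) : Option (Fin P.Δ) :=
  if h : (P.owners ω G v).Nonempty then some (P.extension ω G h.some v) else P.layered ω G v

variable {P ω} {s s' v : V}

theorem rule_subset_centers : P.rule ω G ⊆ centers P.Δ P.g G :=
  ruling_subset

theorem near_of_mem_owners (h : s ∈ P.owners ω G v) : Near G P.g s v :=
  (isGadget_gadget (rule_subset_centers h.1)).1 v h.2

theorem eq_of_mem_rule_of_near (hs : s ∈ P.rule ω G) (hs' : s' ∈ P.rule ω G)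
    (h : Near G P.α s s') : s = s' :=
  eq_of_mem_ruling_of_near (fun v => (ω.1 v).2) hs hs' h

variable (P ω)

theorem isLocal_mem_rule :
    IsLocal (P.g + (P.b + 1) * P.α) fun (G : SimpleGraph V) s => s ∈ P.rule ω G :=
  isLocal_mem_ruling isLocal_mem_centers P.b

theorem isLocal_owners : IsLocal (P.g + (P.b + 1) * P.α + P.g) (P.owners (V := V) ω) := by
  rw [Nat.add_comm]
  intro G G' v hG
  have hmem {s : V} (hs : Near G P.g s v) : s ∈ P.owners ω G v ↔ s ∈ P.owners ω G' v := by
    rw [owners, owners, Set.mem_ofPred_eq, Set.mem_ofPred_eq,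
      (P.isLocal_mem_rule ω).eq_of_near hG hs.symm,
      (isLocal_gadget.mono (Nat.le_add_right _ _)).eq_of_near hG hs.symm]
  have hnear {s : V} : Near G P.g s v ↔ Near G' P.g s v := by
    rw [show Near G P.g s v ↔ Near G P.g v s from ⟨Near.symm, Near.symm⟩,
      (hG.mono (Nat.le_add_right _ _)).near_iff]
    exact ⟨Near.symm, Near.symm⟩
  ext s
  exact ⟨fun hs => (hmem (near_of_mem_owners hs)).1 hs,
    fun hs => (hmem (hnear.2 (near_of_mem_owners hs))).2 hs⟩

theorem isLocal_mem_base : IsLocal (P.g + (P.b + 1) * P.α + P.g)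
    fun (G : SimpleGraph V) v => v ∈ P.base ω G := by
  intro G G' v hG
  simp only [base, Set.mem_ofPred_eq, P.isLocal_owners ω hG]

theorem isLocal_layered : IsLocal (P.g + (P.b + 1) * P.α + P.g + P.R + 2 * (P.R * P.K))
    (P.layered (V := V) ω) :=
  isLocal_colorAfter (P.isLocal_mem_base ω) _

/-- The distance up to which the algorithm looks. -/
def radius : ℕ :=
  P.g + (P.g + (1 + (P.g + (P.b + 1) * P.α + P.g + P.R + 2 * (P.R * P.K))))

theorem isLocal_coloring : IsLocal P.radius (P.coloring (V := V) ω) := by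
  intro G G' v hG
  have howners : P.owners ω G v = P.owners ω G' v :=
    (P.isLocal_owners ω).mono (by simp only [radius]; omega) hG
  have hlayered : P.layered ω G v = P.layered ω G' v :=
    (P.isLocal_layered ω).mono (by simp only [radius]; omega) hG
  rw [coloring, coloring, howners, hlayered]
  split_ifs with h
  · have hs : h.some ∈ P.owners ω G v := howners.symm.subset h.some_mem
    have hGs := hG.shift (near_of_mem_owners hs).symm
    refine congrArg some (congrFun (listColoring_gadget_congr (rule_subset_centers hs.1)
      (hGs.mono (by omega)) fun w hw => ?_) v)
    exact (isLocal_available (P.isLocal_layered ω)) (hGs.shift hw)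
  · rfl

end Params

section Properness

namespace Params

variable {V : Type*} {G : SimpleGraph V} {P : Params} {ω : P.Seed V} {s s' v w : V}

theorem layered_eq_none_of_mem_base (h : v ∈ P.base ω G) : P.layered ω G v = none := by
  by_contra hne
  refine not_within_of_colorAfter hne 0 ?_ ⟨v, h, Near.refl v⟩
  have hpos : 0 < P.R * P.K := pos_of_colorAfter_ne_none hne
  have hlt : (P.R * P.K - 1) / P.K < P.R := by
    rw [Nat.div_lt_iff_lt_mul (Nat.pos_of_mul_pos_left hpos)]
    omega
  omega

theorem owners_eq (hs : s ∈ P.owners ω G v) (hs' : s' ∈ P.owners ω G v) : s = s' := by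
  refine eq_of_mem_rule_of_near hs.1 hs'.1 ?_
  exact ((near_of_mem_owners hs).trans (near_of_mem_owners hs').symm).mono (by rw [α]; omega)

theorem owners_eq_of_adj (hs : s ∈ P.owners ω G v) (hs' : s' ∈ P.owners ω G w)
    (hvw : G.Adj v w) : s = s' := by
  refine eq_of_mem_rule_of_near hs.1 hs'.1 ?_
  exact (((near_of_mem_owners hs).snoc hvw).trans (near_of_mem_owners hs').symm).mono
    (by rw [α]; omega)

theorem isListColoring_extension [Finite V] (hs : s ∈ P.rule ω G) :
    IsListColoring G (gadget P.Δ P.g G s) (available G (P.layered ω G)) (P.extension ω G s) :=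
  isListColoring_listColoring_gadget (rule_subset_centers hs)
    fun _ hv => layered_eq_none_of_mem_base (Or.inr ⟨s, hs, hv⟩)

theorem coloring_of_mem_owners (hs : s ∈ P.owners ω G v) :
    P.coloring ω G v = some (P.extension ω G s v) := by
  have h : (P.owners ω G v).Nonempty := ⟨s, hs⟩
  rw [coloring, dif_pos h, owners_eq h.some_mem hs]

theorem coloring_of_owners_eq_empty (h : P.owners ω G v = ∅) :
    P.coloring ω G v = P.layered ω G v :=
  dif_neg (Set.not_nonempty_iff_eq_empty.2 h)

theorem coloring_ne_of_mem_owners [Finite V] (hs : s ∈ P.owners ω G v) (hvw : G.Adj v w)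
    {c : Fin P.Δ} (hv : P.coloring ω G v = some c) : P.coloring ω G w ≠ some c := by
  have hext := isListColoring_extension hs.1
  rw [coloring_of_mem_owners hs, Option.some_inj] at hv
  rcases (P.owners ω G w).eq_empty_or_nonempty with hw | ⟨s', hs'⟩
  · rw [coloring_of_owners_eq_empty hw]
    exact mem_available.1 (hv ▸ hext.1 v hs.2) w hvw
  · obtain rfl := owners_eq_of_adj hs hs' hvw
    rw [coloring_of_mem_owners hs', ← hv, ne_eq, Option.some_inj]
    exact (hext.2 v hs.2 w hs'.2 hvw).symm

theorem isProper_coloring [Finite V] : IsProper G (P.coloring ω G) := by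
  intro v w hvw c hv hw
  rcases (P.owners ω G v).eq_empty_or_nonempty with hv' | ⟨s, hs⟩
  · rcases (P.owners ω G w).eq_empty_or_nonempty with hw' | ⟨s, hs⟩
    · rw [coloring_of_owners_eq_empty hv'] at hv
      rw [coloring_of_owners_eq_empty hw'] at hw
      exact isProper_colorAfter _ hvw hv hw
    · exact coloring_ne_of_mem_owners hs hvw.symm hw hv
  · exact coloring_ne_of_mem_owners hs hvw hv hw

theorem within_of_mem_candidates
    (h : v ∈ candidates P.α (fun w => (ω.1 w : ℕ)) G (centers P.Δ P.g G)) :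
    Within G P.R (P.base ω G) v := by
  obtain ⟨s, hs, hvs⟩ := exists_mem_ruling_near h P.b
  obtain ⟨hnear, ⟨x, hx⟩, -⟩ := isGadget_gadget (ruling_subset hs)
  exact ⟨x, Or.inr ⟨s, hs, hx⟩, hvs.trans (hnear x hx)⟩

theorem of_coloring_eq_none (h : P.coloring ω G v = none) :
    ω.2.1 v = 0 ∨ ¬ Within G P.R (P.base ω G) v ∨
      ∃ l < P.R, Within G (l + 1) (P.base ω G) v ∧ ¬ Within G l (P.base ω G) v ∧
        P.layered ω G v = none := by
  classical
  by_cases h0 : ω.2.1 v = 0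
  · exact Or.inl h0
  by_cases hR : Within G P.R (P.base ω G) v
  swap
  · exact Or.inr (Or.inl hR)
  have howners : P.owners ω G v = ∅ := by
    refine Set.not_nonempty_iff_eq_empty.1 fun ⟨s, hs⟩ => ?_
    rw [coloring_of_mem_owners hs] at h
    exact Option.some_ne_none _ h
  rw [coloring_of_owners_eq_empty howners] at h
  have hex : ∃ l, Within G l (P.base ω G) v := ⟨_, hR⟩
  obtain ⟨l, hl⟩ : ∃ l, Nat.find hex = l + 1 := by
    refine Nat.exists_eq_succ_of_ne_zero fun e => ?_
    obtain ⟨z, hz, hvz⟩ := (Nat.find_eq_zero hex).1 e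
    obtain rfl := near_zero_iff.1 hvz
    exact hz.elim h0 fun hz => Set.not_nonempty_iff_eq_empty.2 howners hz
  have hlR := Nat.find_min' hex hR
  exact Or.inr (Or.inr ⟨l, by omega, hl ▸ Nat.find_spec hex, Nat.find_min hex (by omega), h⟩)

end Params

end Properness

/-! ### Uniform probabilities -/

section Probability

open scoped BigOperators

/-- The probability of `A` under the uniform distribution on a finite type. -/
noncomputable def prob {Ω : Type*} [Fintype Ω] (A : Set Ω) : ℝ :=
  𝔼 ω, A.indicator 1 ω

variable {Ω Ω' : Type*} [Fintype Ω] [Fintype Ω'] {A B : Set Ω}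

theorem prob_mono (h : A ⊆ B) : prob A ≤ prob B :=
  Finset.expect_le_expect fun _ _ =>
    Set.indicator_le_indicator_of_subset h (fun _ => zero_le_one) _

@[simp]
theorem prob_empty : prob (∅ : Set Ω) = 0 := by
  simp [prob]

theorem prob_le_one [Nonempty Ω] : prob A ≤ 1 :=
  Finset.expect_le Finset.univ_nonempty fun _ _ =>
    Set.indicator_le_self' (fun _ _ => zero_le_one) _

theorem prob_union_le : prob (A ∪ B) ≤ prob A + prob B := by
  rw [prob, prob, prob, ← Finset.expect_add_distrib]
  refine Finset.expect_le_expect fun ω _ => ?_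
  rw [← Set.indicator_union_add_inter_apply]
  exact le_add_of_nonneg_right (Set.indicator_nonneg (fun _ _ => zero_le_one) _)

theorem prob_biUnion_le {ι : Type*} (s : Finset ι) (A : ι → Set Ω) :
    prob (⋃ i ∈ s, A i) ≤ ∑ i ∈ s, prob (A i) := by
  classical
  induction s using Finset.induction_on with
  | empty => simp
  | insert a s ha ih =>
    rw [Finset.set_biUnion_insert, Finset.sum_insert ha]
    exact prob_union_le.trans (by gcongr)

theorem prob_eq_card_div (A : Set Ω) : prob A = A.ncard / Fintype.card Ω := by
  classical
  rw [prob, Fintype.expect_eq_sum_div_card, Finset.sum_indicator_eq_sum_filter,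
    Set.ncard_eq_toFinset_card', ← Set.filter_mem_univ_eq_toFinset]
  simp only [Pi.one_apply, Finset.sum_const, nsmul_eq_mul, mul_one]

theorem prob_le_of_subsingleton (h : A.Subsingleton) : prob A ≤ 1 / Fintype.card Ω := by
  rw [prob_eq_card_div]
  gcongr
  exact_mod_cast Set.ncard_le_one_iff_subsingleton.2 h

theorem prob_prod (A : Set (Ω × Ω')) : prob A = 𝔼 ω, prob {ω' | (ω, ω') ∈ A} := by
  rw [prob, ← Finset.univ_product_univ, Finset.expect_product]
  rfl

theorem prob_prod_le {A : Set (Ω × Ω')} {a : ℝ} [Nonempty Ω]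
    (h : ∀ ω, prob {ω' | (ω, ω') ∈ A} ≤ a) : prob A ≤ a := by
  rw [prob_prod]
  exact Finset.expect_le Finset.univ_nonempty fun ω _ => h ω

theorem prob_fst [Nonempty Ω'] (A : Set Ω) : prob {ω : Ω × Ω' | ω.1 ∈ A} = prob A := by
  rw [prob_prod, prob]
  refine Finset.expect_congr rfl fun ω _ => ?_
  exact Fintype.expect_const (A.indicator (1 : Ω → ℝ) ω)

theorem prob_snd [Nonempty Ω] (A : Set Ω') : prob {ω : Ω × Ω' | ω.2 ∈ A} = prob A := by
  rw [prob_prod]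
  exact Fintype.expect_const (prob A)

section Resampling

variable {ι : Type*} [Fintype ι] [DecidableEq ι] {R : ι → Type*} [∀ i, Fintype (R i)]
  [∀ i, Nonempty (R i)]

theorem expect_update (i : ι) (f : (∀ i, R i) → ℝ) :
    𝔼 ω, 𝔼 r : R i, f (Function.update ω i r) = 𝔼 ω, f ω := by
  let swap : ((∀ i, R i) × R i) ≃ ((∀ i, R i) × R i) :=
    { toFun := fun x => (Function.update x.1 i x.2, x.1 i)
      invFun := fun x => (Function.update x.1 i x.2, x.1 i)
      left_inv := fun x => by simp
      right_inv := fun x => by simp }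
  have hswap : 𝔼 x : (∀ i, R i) × R i, f (Function.update x.1 i x.2) =
      𝔼 x : (∀ i, R i) × R i, f x.1 :=
    Fintype.expect_equiv swap _ _ fun _ => rfl
  rw [← Finset.univ_product_univ, Finset.expect_product, Finset.expect_product] at hswap
  simpa only [Fintype.expect_const] using hswap

theorem prob_eq_expect_update (i : ι) (A : Set (∀ i, R i)) :
    prob A = 𝔼 ω, prob {r : R i | Function.update ω i r ∈ A} :=
  (expect_update i _).symm

theorem prob_le_mul_prob_of_update {i : ι} {A B : Set (∀ i, R i)} {a : ℝ}
    (h : ∀ ω ∈ B, prob {r : R i | Function.update ω i r ∈ A} ≤ a)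
    (h' : ∀ ω ∉ B, ∀ r : R i, Function.update ω i r ∉ A) : prob A ≤ a * prob B := by
  rw [prob_eq_expect_update i, prob, Finset.mul_expect]
  refine Finset.expect_le_expect fun ω _ => ?_
  by_cases hω : ω ∈ B
  · simpa [hω] using h ω hω
  · have hempty : {r : R i | Function.update ω i r ∈ A} = ∅ :=
      Set.eq_empty_of_forall_notMem (h' ω hω)
    simp [hω, hempty]

theorem prob_apply_mem (i : ι) (A : Set (R i)) : prob {ω : ∀ i, R i | ω i ∈ A} = prob A := by
  rw [prob_eq_expect_update i]
  simp only [Set.mem_ofPred_eq, Function.update_self]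
  exact Fintype.expect_const _

end Resampling

end Probability

section TrialFailure

variable {V : Type*} {Δ R K τ l : ℕ} {G : SimpleGraph V} {B U : Set V} {col : V → Option (Fin Δ)}
  {u v : V}

instance : Nonempty (ColorChoice Δ) :=
  ⟨fun A => ⟨A.2.choose, A.2.choose_spec⟩⟩

theorem prob_pick_eq_le (A : Finset (Fin Δ)) (c : Fin Δ) :
    prob {f : ColorChoice Δ | f.pick A = some c} ≤ 1 / A.card := by
  by_cases hA : A.Nonempty
  · have hpick : {f : ColorChoice Δ | f.pick A = some c} =
        {f : ColorChoice Δ | f ⟨A, hA⟩ ∈ {x : {c // c ∈ A} | x.1 = c}} := by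
      ext f
      simp [ColorChoice.pick, hA]
    have (A : {A : Finset (Fin Δ) // A.Nonempty}) : Nonempty {c // c ∈ A.1} := A.2.to_subtype
    rw [hpick, prob_apply_mem (R := fun A : {A : Finset (Fin Δ) // A.Nonempty} => {c // c ∈ A.1})
      ⟨A, hA⟩ {x | x.1 = c}, ← Fintype.card_coe A]
    exact prob_le_of_subsingleton fun x hx y hy => Subtype.ext (hx.trans hy.symm)
  · simp [ColorChoice.pick, hA]

theorem prob_bool_eq_le (s : Bool) : prob {s' : Bool | s' = s} ≤ 1 / 2 := by
  simpa using prob_le_of_subsingleton (A := {s' : Bool | s' = s})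
    fun x hx y hy => hx.trans hy.symm

theorem prob_active_and_pick_eq_le (A : Finset (Fin Δ)) (c : Fin Δ) :
    prob {x : Bool × ColorChoice Δ | x.1 = true ∧ x.2.pick A = some c} ≤ 1 / 2 * (1 / A.card) := by
  rw [prob_prod]
  have hsplit (s : Bool) : prob {f : ColorChoice Δ | s = true ∧ f.pick A = some c} ≤
      {s' : Bool | s' = true}.indicator 1 s * (1 / A.card) := by
    cases s
    · simp
    · simpa using prob_pick_eq_le A c
  refine (Finset.expect_le_expect fun s _ => hsplit s).trans ?_
  rw [← Finset.expect_mul]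
  exact mul_le_mul_of_nonneg_right (prob_bool_eq_le true) (by positivity)

theorem colorAfter_congr {ρ ρ' : Fin (R * K) → V → Bool × ColorChoice Δ}
    (h : ∀ i : Fin (R * K), i < τ → ρ i = ρ' i) :
    colorAfter R K ρ G B τ = colorAfter R K ρ' G B τ := by
  induction τ with
  | zero => rfl
  | succ τ ih =>
    rw [colorAfter, colorAfter, ih fun i hi => h i (by omega)]
    split_ifs with hτ
    · rw [h ⟨τ, hτ⟩ τ.lt_succ_self]
    · rfl

theorem colorAfter_update {ρ : Fin (R * K) → V → Bool × ColorChoice Δ} (hτ : τ < R * K)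
    (r : V → Bool × ColorChoice Δ) :
    colorAfter R K (Function.update ρ ⟨τ, hτ⟩ r) G B τ = colorAfter R K ρ G B τ := by
  refine colorAfter_congr fun i hi => Function.update_of_ne ?_ _ _
  rintro rfl
  exact lt_irrefl _ hi

theorem colorAfter_update_succ {ρ : Fin (R * K) → V → Bool × ColorChoice Δ} (hτ : τ < R * K)
    (r : V → Bool × ColorChoice Δ) :
    colorAfter R K (Function.update ρ ⟨τ, hτ⟩ r) G B (τ + 1) =
      trial r G (turn R K G B τ) (colorAfter R K ρ G B τ) := by
  rw [colorAfter, dif_pos hτ, Function.update_self, colorAfter_update]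

theorem exists_conflict_of_trial_eq_none {r : V → Bool × ColorChoice Δ} (hU : v ∈ U)
    (hv : col v = none) (hA : (available G col v).Nonempty) (h : trial r G U col v = none)
    (hactive : (r v).1 = true) :
    ∃ u ∈ G.neighborSet v ∩ (U ∩ {u | col u = none}),
      ∃ c, attempt r G U col u = some c ∧ attempt r G U col v = some c := by
  obtain ⟨c, hc⟩ : ∃ c, attempt r G U col v = some c := by
    rw [attempt, if_pos ⟨hU, hv, hactive⟩, ColorChoice.pick, dif_pos hA]
    exact ⟨_, rfl⟩
  rw [trial, hc] at h
  split_ifs at h with hkeep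
  obtain ⟨u, huv, hu⟩ : ∃ u, G.Adj v u ∧ attempt r G U col u = some c := by
    simpa using hkeep
  have hu' := (attempt_eq_some hu).1
  exact ⟨u, ⟨huv, hu'.1, hu'.2.1⟩, c, hu, hc⟩

theorem lt_card_available [Finite V] (hΔ : (G.neighborSet v).ncard ≤ Δ) (huv : G.Adj v u)
    (hu : col u = none) (huU : u ∉ U) :
    degIn G (U ∩ {w | col w = none}) v < (available G col v).card := by
  have hlt : degIn G ({w | col w = none} \ {u}) v < degIn G {w | col w = none} v :=
    degIn_diff_lt hu rfl huv
  have hle : degIn G (U ∩ {w | col w = none}) v ≤ degIn G ({w | col w = none} \ {u}) v :=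
    degIn_mono (fun w hw => And.intro hw.2 fun e : w = u => huU (e ▸ hw.1)) v
  have hsum : degIn G {w | col w = none} v + degIn G {w | col w ≠ none} v ≤ Δ :=
    (degIn_add_degIn_compl G {w | col w = none} v).trans_le hΔ
  have havail := le_card_available_add_degIn G col v
  omega

variable [Fintype V] [DecidableEq V]

theorem prob_active_eq_le (v : V) (s : Bool) :
    prob {r : V → Bool × ColorChoice Δ | (r v).1 = s} ≤ 1 / 2 :=
  calc prob {r : V → Bool × ColorChoice Δ | (r v).1 = s}
      = prob {x : Bool × ColorChoice Δ | x.1 = s} :=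
        prob_apply_mem (R := fun _ : V => Bool × ColorChoice Δ) v {x | x.1 = s}
    _ = prob {s' : Bool | s' = s} := prob_fst {s' : Bool | s' = s}
    _ ≤ 1 / 2 := prob_bool_eq_le s

theorem prob_conflict_le (huv : u ≠ v) :
    prob {r : V → Bool × ColorChoice Δ | ∃ c, attempt r G U col u = some c ∧
      attempt r G U col v = some c} ≤ 1 / 2 * (1 / (available G col v).card) * (1 / 2) := by
  have hu (r : V → Bool × ColorChoice Δ) (x : Bool × ColorChoice Δ) :
      attempt (Function.update r v x) G U col u = attempt r G U col u := by
    rw [attempt, attempt, Function.update_of_ne huv]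
  refine le_trans (prob_le_mul_prob_of_update (i := v) (B := {r | (r u).1 = true})
    (a := 1 / 2 * (1 / (available G col v).card)) (fun r _ => ?_) fun r hr x hx => ?_)
    (mul_le_mul_of_nonneg_left (prob_active_eq_le u true) (by positivity))
  · simp only [Set.mem_ofPred_eq, hu]
    rcases attempt r G U col u with _ | c
    · simp
    · refine (prob_mono ?_).trans (prob_active_and_pick_eq_le (available G col v) c)
      rintro x ⟨c', hc, hv⟩
      obtain rfl := Option.some.inj hc
      rw [attempt] at hv
      split_ifs at hv with hactive
      rw [Function.update_self] at hv hactive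
      exact ⟨hactive.2.2, hv⟩
  · obtain ⟨c, hc, -⟩ := hx
    exact hr (attempt_eq_some (hu r x ▸ hc)).1.2.2

theorem prob_trial_eq_none_le (hU : v ∈ U) (hv : col v = none)
    (hA : degIn G (U ∩ {u | col u = none}) v < (available G col v).card) :
    prob {r : V → Bool × ColorChoice Δ | trial r G U col v = none} ≤ 3 / 4 := by
  have hcard : 0 < (available G col v).card := hA.pos
  let M : Finset V := (Set.toFinite (G.neighborSet v ∩ (U ∩ {u | col u = none}))).toFinset
  have hM : M.card = degIn G (U ∩ {u | col u = none}) v :=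
    (Set.ncard_eq_toFinset_card _).symm
  have hcover : {r : V → Bool × ColorChoice Δ | trial r G U col v = none} ⊆
      {r | (r v).1 = false} ∪ ⋃ u ∈ M, {r | ∃ c, attempt r G U col u = some c ∧
        attempt r G U col v = some c} := by
    intro r hr
    rcases Bool.eq_false_or_eq_true (r v).1 with hactive | hidle
    · obtain ⟨u, hu, hc⟩ :=
        exists_conflict_of_trial_eq_none hU hv (Finset.card_pos.1 hcard) hr hactive
      exact Or.inr (Set.mem_biUnion ((Set.Finite.mem_toFinset _).2 hu) hc)
    · exact Or.inl hidle
  have hconflict := (prob_biUnion_le M fun u => {r : V → Bool × ColorChoice Δ |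
      ∃ c, attempt r G U col u = some c ∧ attempt r G U col v = some c}).trans
    (Finset.sum_le_card_nsmul M _ _ fun u hu =>
      prob_conflict_le ((Set.Finite.mem_toFinset _).1 hu).1.ne.symm)
  have hratio : (M.card : ℝ) * (1 / (available G col v).card) ≤ 1 := by
    rw [mul_one_div, div_le_one (by exact_mod_cast hcard), hM]
    exact_mod_cast hA.le
  rw [nsmul_eq_mul] at hconflict
  linarith [prob_mono hcover, prob_union_le.trans (add_le_add_right hconflict
    (prob {r : V → Bool × ColorChoice Δ | (r v).1 = false})),
    prob_active_eq_le (Δ := Δ) v false]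

theorem prob_colorAfter_succ_le (hΔ : (G.neighborSet v).ncard ≤ Δ) (hl : l < R)
    (h : Within G (l + 1) B v) (h' : ¬ Within G l B v) (hτ : τ < R * K)
    (hdiv : τ / K = R - (l + 1)) :
    prob {ρ : Fin (R * K) → V → Bool × ColorChoice Δ | colorAfter R K ρ G B (τ + 1) v = none} ≤
      3 / 4 * prob {ρ : Fin (R * K) → V → Bool × ColorChoice Δ |
        colorAfter R K ρ G B τ v = none} := by
  have hdist : R - τ / K = l + 1 := by omega
  refine prob_le_mul_prob_of_update (i := (⟨τ, hτ⟩ : Fin (R * K))) (fun ρ hρ => ?_)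
    fun ρ hρ r => ?_
  · simp only [Set.mem_ofPred_eq, colorAfter_update_succ]
    obtain ⟨u, hvu, hu⟩ := h.exists_adj h'
    have hturn : v ∈ turn R K G B τ := by
      rw [turn, hdist]
      exact ⟨h, h'⟩
    have hu_turn : u ∉ turn R K G B τ := by
      rw [turn, hdist]
      exact fun hmem => hmem.2 hu
    have hu_none : colorAfter R K ρ G B τ u = none := by
      by_contra hne
      have hmono : (τ - 1) / K ≤ τ / K := Nat.div_le_div_right (Nat.sub_le τ 1)
      exact not_within_of_colorAfter hne l (by omega) hu
    exact prob_trial_eq_none_le hturn hρ (lt_card_available hΔ hvu hu_none hu_turn)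
  · simp only [Set.mem_ofPred_eq, colorAfter_update_succ]
    rwa [trial_of_colored hρ]

theorem prob_colorAfter_eq_none_le (hΔ : (G.neighborSet v).ncard ≤ Δ) (hl : l < R)
    (h : Within G (l + 1) B v) (h' : ¬ Within G l B v) :
    prob {ρ : Fin (R * K) → V → Bool × ColorChoice Δ | colorAfter R K ρ G B (R * K) v = none} ≤
      (3 / 4) ^ K := by
  have hend : (R - (l + 1)) * K + K ≤ R * K := by
    rw [← Nat.succ_mul]
    exact Nat.mul_le_mul_right K (by omega)
  have hwindow (j : ℕ) (hj : j ≤ K) :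
      prob {ρ : Fin (R * K) → V → Bool × ColorChoice Δ |
        colorAfter R K ρ G B ((R - (l + 1)) * K + j) v = none} ≤ (3 / 4) ^ j := by
    induction j with
    | zero => simpa using prob_le_one
    | succ j ih =>
      have hdiv : ((R - (l + 1)) * K + j) / K = R - (l + 1) := by
        rw [mul_comm, Nat.mul_add_div (by omega), Nat.div_eq_of_lt (by omega), add_zero]
      rw [pow_succ']
      exact (prob_colorAfter_succ_le hΔ hl h h' (by omega) hdiv).trans
        (mul_le_mul_of_nonneg_left (ih (by omega)) (by norm_num))
  refine (prob_mono fun ρ hρ => ?_).trans (hwindow K le_rfl)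
  by_contra hne
  exact colorAfter_ne_none_mono hend hne hρ

end TrialFailure

section Failure

variable {V : Type*} [Fintype V] [DecidableEq V]

theorem prob_fin_ne_zero_le (Q : ℕ) [NeZero Q] : prob {r : Fin Q | r ≠ 0} ≤ 1 - 1 / (Q : ℝ) := by
  have hQ : (Q : ℝ) ≠ 0 := Nat.cast_ne_zero.2 (NeZero.ne Q)
  have hcompl : {r : Fin Q | r ≠ 0} = {0}ᶜ := rfl
  have hcard := Set.ncard_add_ncard_compl ({0} : Set (Fin Q))
  rw [Set.ncard_singleton, Nat.card_fin] at hcard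
  rw [prob_eq_card_div, hcompl, Fintype.card_fin, le_sub_iff_add_le, ← add_div,
    div_le_one (by positivity)]
  exact_mod_cast (Nat.add_comm _ _).trans_le hcard.le

theorem prob_forall_ne_zero_le {Q : ℕ} [NeZero Q] (S : Finset V) :
    prob {f : V → Fin Q | ∀ x ∈ S, f x ≠ 0} ≤ (1 - 1 / (Q : ℝ)) ^ S.card := by
  induction S using Finset.induction_on with
  | empty => simpa using prob_le_one
  | insert a S ha ih =>
    have hQ : (0 : ℝ) ≤ 1 - 1 / (Q : ℝ) := by
      rw [sub_nonneg, div_le_one (by exact_mod_cast NeZero.pos Q)]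
      exact_mod_cast NeZero.one_le
    rw [Finset.card_insert_of_notMem ha, pow_succ']
    refine le_trans (prob_le_mul_prob_of_update (i := a) (B := {f | ∀ x ∈ S, f x ≠ 0})
      (fun f _ => (prob_mono fun r hr => ?_).trans (prob_fin_ne_zero_le Q)) fun f hf r hr => ?_)
      (mul_le_mul_of_nonneg_left ih hQ)
    · simpa using hr a (Finset.mem_insert_self a S)
    · refine hf fun x hx => ?_
      simpa [ne_of_mem_of_not_mem hx ha] using hr x (Finset.mem_insert_of_mem hx)

theorem one_sub_inv_pow_le {Q n : ℕ} (hQ : 0 < Q) (hn : Q ^ 2 ≤ n) :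
    (1 - 1 / (Q : ℝ)) ^ n ≤ 1 / Q := by
  have hnonneg : (0 : ℝ) ≤ 1 - 1 / (Q : ℝ) := by
    rw [sub_nonneg, div_le_one (by positivity)]
    exact_mod_cast hQ
  calc (1 - 1 / (Q : ℝ)) ^ n
      ≤ (1 - 1 / (Q : ℝ)) ^ Q ^ 2 :=
        pow_le_pow_of_le_one hnonneg (sub_le_self 1 (by positivity)) hn
    _ ≤ Real.exp (-(1 / Q)) ^ Q ^ 2 :=
        pow_le_pow_left₀ hnonneg (Real.one_sub_le_exp_neg _) _
    _ = Real.exp (-Q) := by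
        rw [← Real.exp_nat_mul]
        congr 1
        push_cast
        field_simp
    _ ≤ 1 / Q := by
        rw [Real.exp_neg, ← one_div]
        exact one_div_le_one_div_of_le (by positivity)
          ((le_add_of_nonneg_right zero_le_one).trans (Real.add_one_le_exp (Q : ℝ)))

theorem prob_label_eq_le {m : ℕ} [NeZero m] {v w : V} (h : w ≠ v) :
    prob {f : V → Fin m | f w = f v} ≤ 1 / m := by
  have huniv : prob {f : V → Fin m | f w = f v} ≤
      1 / m * prob (Set.univ : Set (V → Fin m)) := by
    refine prob_le_mul_prob_of_update (i := w) (fun f _ => ?_) fun f hf => absurd trivial hf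
    simpa [Function.update_of_ne h.symm] using prob_le_of_subsingleton
      (A := {r : Fin m | r = f v}) fun x hx y hy => hx.trans hy.symm
  exact huniv.trans (mul_le_of_le_one_right (by positivity) prob_le_one)

namespace Params

variable (P : Params) {G : SimpleGraph V} {v : V}

theorem prob_removed_le (v : V) : prob {ω : P.Seed V | ω.2.1 v = 0} ≤ 1 / P.Q := by
  have hmarginal : prob {ω : P.Seed V | ω.2.1 v = 0} = prob {r : Fin P.Q | r = 0} :=
    (prob_snd {x : (V → Fin P.Q) × (Fin (P.R * P.K) → V → Bool × ColorChoice P.Δ) |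
      x.1 v = 0}).trans ((prob_fst {f : V → Fin P.Q | f v = 0}).trans
      (prob_apply_mem (R := fun _ : V => Fin P.Q) v {r | r = 0}))
  rw [hmarginal]
  simpa using prob_le_of_subsingleton (A := {r : Fin P.Q | r = 0})
    fun x hx y hy => hx.trans hy.symm

theorem prob_not_within_le_of_mem_centers (hΔ : ∀ v, (G.neighborSet v).ncard ≤ P.Δ)
    (hb : (P.Δ + 1) ^ P.α * P.Q ≤ 2 ^ P.b) (hv : v ∈ centers P.Δ P.g G) :
    prob {ω : P.Seed V | ¬ Within G P.R (P.base ω G) v} ≤ 1 / P.Q := by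
  let S : Finset V := ((Set.toFinite {w | Near G P.α v w}).toFinset).erase v
  have hcover : {ω : P.Seed V | ¬ Within G P.R (P.base ω G) v} ⊆
      ⋃ w ∈ S, {ω : P.Seed V | ω.1 w = ω.1 v} := by
    intro ω hω
    by_contra hne
    refine hω (within_of_mem_candidates ⟨hv, fun w _ hw hwv e => hne ?_⟩)
    exact Set.mem_biUnion (Finset.mem_erase.2 ⟨hwv, (Set.Finite.mem_toFinset _).2 hw⟩) (Fin.ext e)
  have hlabel (w : V) (hw : w ∈ S) :
      prob {ω : P.Seed V | ω.1 w = ω.1 v} ≤ 1 / (2 ^ P.b : ℕ) :=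
    (prob_fst {f : V → Fin (2 ^ P.b) | f w = f v}).trans_le
      (prob_label_eq_le (Finset.ne_of_mem_erase hw))
  have hcard : S.card ≤ (P.Δ + 1) ^ P.α := by
    refine Finset.card_erase_le.trans ?_
    rw [← Set.ncard_eq_toFinset_card]
    exact ncard_ball_le hΔ P.α v
  calc prob {ω : P.Seed V | ¬ Within G P.R (P.base ω G) v}
      ≤ ∑ w ∈ S, prob {ω : P.Seed V | ω.1 w = ω.1 v} :=
        (prob_mono hcover).trans (prob_biUnion_le _ _)
    _ ≤ S.card • (1 / (2 ^ P.b : ℕ) : ℝ) := Finset.sum_le_card_nsmul _ _ _ hlabel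
    _ ≤ 1 / P.Q := by
        rw [nsmul_eq_mul, mul_one_div, div_le_div_iff₀ (by positivity)
          (by exact_mod_cast P.Q_pos), one_mul]
        exact_mod_cast (Nat.mul_le_mul_right P.Q hcard).trans hb

theorem prob_not_within_le_of_notMem_centers (hΔ : ∀ v, (G.neighborSet v).ncard ≤ P.Δ)
    (hG : G.CliqueFree (P.Δ + 1)) {k : ℕ} (hk : 2 * k ≤ P.g) (hQ : P.Q ^ 2 ≤ (P.Δ - 1) ^ k)
    (hv : v ∉ centers P.Δ P.g G) :
    prob {ω : P.Seed V | ¬ Within G P.R (P.base ω G) v} ≤ 1 / P.Q := by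
  have hrigid : Rigid P.Δ G v P.g :=
    ⟨hΔ, P.three_le, hG, fun F hne hF hflex => hv ⟨F, hF, hne, hflex⟩⟩
  let S : Finset V := (Set.toFinite {w | Near G P.g v w}).toFinset
  have hcover : {ω : P.Seed V | ¬ Within G P.R (P.base ω G) v} ⊆
      {ω | ω.2.1 ∈ {f : V → Fin P.Q | ∀ x ∈ S, f x ≠ 0}} := by
    intro ω hω x hx hzero
    exact hω ⟨x, Or.inl hzero, ((Set.Finite.mem_toFinset _).1 hx).mono (Nat.le_add_left _ _)⟩
  have hmarginal : prob {ω : P.Seed V | ω.2.1 ∈ {f : V → Fin P.Q | ∀ x ∈ S, f x ≠ 0}} =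
      prob {f : V → Fin P.Q | ∀ x ∈ S, f x ≠ 0} :=
    (prob_snd {x : (V → Fin P.Q) × (Fin (P.R * P.K) → V → Bool × ColorChoice P.Δ) |
      x.1 ∈ {f : V → Fin P.Q | ∀ x ∈ S, f x ≠ 0}}).trans (prob_fst _)
  have hcard : P.Q ^ 2 ≤ S.card := by
    rw [← Set.ncard_eq_toFinset_card]
    exact hQ.trans (hrigid.pow_le_ncard_ball hk)
  exact (prob_mono hcover).trans (hmarginal.trans_le
    ((prob_forall_ne_zero_le S).trans (one_sub_inv_pow_le P.Q_pos hcard)))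

theorem prob_unlucky_le (hΔ : ∀ v, (G.neighborSet v).ncard ≤ P.Δ) (v : V) :
    prob {ω : P.Seed V | ∃ l < P.R, Within G (l + 1) (P.base ω G) v ∧
      ¬ Within G l (P.base ω G) v ∧ P.layered ω G v = none} ≤ (3 / 4) ^ P.K := by
  refine prob_prod_le fun h => prob_prod_le fun rem => ?_
  let B : Set V := P.base (h, rem, Classical.arbitrary _) G
  change prob {ρ : Fin (P.R * P.K) → V → Bool × ColorChoice P.Δ | ∃ l < P.R, Within G (l + 1) B v ∧
    ¬ Within G l B v ∧ colorAfter P.R P.K ρ G B (P.R * P.K) v = none} ≤ _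
  by_cases hl : ∃ l < P.R, Within G (l + 1) B v ∧ ¬ Within G l B v
  · obtain ⟨l, hl, hw, hw'⟩ := hl
    refine (prob_mono fun ρ hρ => ?_).trans (prob_colorAfter_eq_none_le (hΔ v) hl hw hw')
    obtain ⟨_, _, _, _, hρ⟩ := hρ
    exact hρ
  · refine (prob_mono (B := ∅) ?_).trans (prob_empty.trans_le (by positivity))
    rintro ρ ⟨l, hlR, hw, hw', -⟩
    exact hl ⟨l, hlR, hw, hw'⟩

theorem prob_coloring_eq_none_le (hΔ : ∀ v, (G.neighborSet v).ncard ≤ P.Δ)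
    (hG : G.CliqueFree (P.Δ + 1)) (hb : (P.Δ + 1) ^ P.α * P.Q ≤ 2 ^ P.b) {k : ℕ}
    (hk : 2 * k ≤ P.g) (hQ : P.Q ^ 2 ≤ (P.Δ - 1) ^ k) (hK : (3 / 4 : ℝ) ^ P.K ≤ 1 / P.Q) (v : V) :
    prob {ω : P.Seed V | P.coloring ω G v = none} ≤ 3 / P.Q := by
  have hfar : prob {ω : P.Seed V | ¬ Within G P.R (P.base ω G) v} ≤ 1 / P.Q := by
    by_cases hv : v ∈ centers P.Δ P.g G
    · exact P.prob_not_within_le_of_mem_centers hΔ hb hv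
    · exact P.prob_not_within_le_of_notMem_centers hΔ hG hk hQ hv
  calc prob {ω : P.Seed V | P.coloring ω G v = none}
      ≤ 1 / P.Q + (1 / P.Q + 1 / P.Q) :=
        (prob_mono fun ω hω => of_coloring_eq_none hω).trans (prob_union_le.trans
          (add_le_add (P.prob_removed_le v) (prob_union_le.trans
            (add_le_add hfar ((P.prob_unlucky_le hΔ v).trans hK)))))
    _ = 3 / P.Q := by ring

end Params

end Failure

/-! ### Fractional colourings from random choices -/

section Encoding

variable {C : Type} [Finite C]

/-- The positive integer that encodes a colour of an arbitrary finite type. -/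
noncomputable def colorCode (c : C) : ℕ :=
  Finite.equivFin C c + 1

/-- A set of colours of an arbitrary finite type, encoded by positive integers. -/
noncomputable def encodeColors (Y : Set C) : Finset ℕ :=
  (Set.toFinite (colorCode '' Y)).toFinset

variable {Y Z : Set C}

theorem colorCode_injective : Function.Injective (colorCode (C := C)) := fun _ _ h =>
  (Finite.equivFin C).injective (Fin.ext (Nat.succ.inj h))

theorem colorCode_mem_Icc (c : C) : colorCode c ∈ Finset.Icc 1 (Nat.card C) :=
  Finset.mem_Icc.2 ⟨Nat.le_add_left _ _, (Finite.equivFin C c).2⟩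

theorem card_encodeColors (Y : Set C) : (encodeColors Y).card = Y.ncard := by
  rw [encodeColors, ← Set.ncard_eq_toFinset_card (colorCode '' Y),
    Set.ncard_image_of_injective _ colorCode_injective]

theorem encodeColors_subset : encodeColors Y ⊆ Finset.Icc 1 (Nat.card C) := by
  intro x hx
  obtain ⟨c, _, rfl⟩ := (Set.Finite.mem_toFinset _).1 hx
  exact colorCode_mem_Icc c

theorem disjoint_encodeColors (h : Disjoint Y Z) : Disjoint (encodeColors Y) (encodeColors Z) :=
  Set.Finite.disjoint_toFinset.2 ((Set.disjoint_image_iff colorCode_injective).2 h)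

theorem isFractionalColoring_encodeColors [Nonempty C] {V : Type u} {G : SimpleGraph V} {r : ℝ}
    (hr : 1 ≤ r) {Y : V → Set C} (hcard : ∀ v, (Nat.card C : ℝ) ≤ r * (Y v).ncard)
    (hdisj : ∀ v w, G.Adj v w → Disjoint (Y v) (Y w)) :
    IsFractionalColoring G r fun v => encodeColors (Y v) := by
  have hr0 : 0 < r := by linarith
  have hC : (0 : ℝ) < Nat.card C := by exact_mod_cast Nat.card_pos
  have hq : 0 < ⌈(Nat.card C : ℝ) / r⌉₊ := Nat.ceil_pos.2 (by positivity)
  refine ⟨Nat.card C, ⌈(Nat.card C : ℝ) / r⌉₊, ⟨hq, ?_, fun _ => encodeColors_subset, fun v => ?_,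
    fun v w hvw => disjoint_encodeColors (hdisj v w hvw)⟩, ?_⟩
  · exact Nat.ceil_le.2 (div_le_self hC.le hr)
  · rw [card_encodeColors, Nat.ceil_le, div_le_iff₀' hr0]
    exact hcard v
  · rw [div_le_iff₀ (by exact_mod_cast hq), ← div_le_iff₀' hr0]
    exact Nat.le_ceil _

end Encoding

section RandomColoring

variable {Ω X : Type} {V : Type u} {G : SimpleGraph V}

/-- The colours of `v` in the fractional colouring that has a copy of each colour for every
outcome `ω` of the random colouring `χ`. -/
def outcomeColors (χ : Ω → V → Option X) (v : V) : Set (Ω × X) :=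
  {x | χ x.1 v = some x.2}

theorem ncard_outcomeColors (χ : Ω → V → Option X) (v : V) :
    (outcomeColors χ v).ncard = {ω | χ ω v = none}ᶜ.ncard := by
  refine Set.ncard_congr (fun x _ => x.1) (fun x hx => ?_) (fun x y hx hy e => ?_) fun ω hω => ?_
  · rw [Set.mem_compl_iff, Set.mem_ofPred_eq, show χ x.1 v = some x.2 from hx]
    exact Option.some_ne_none _
  · refine Prod.ext e (Option.some.inj ?_)
    rw [← show χ x.1 v = some x.2 from hx, ← show χ y.1 v = some y.2 from hy, e]
  · obtain ⟨c, hc⟩ := Option.ne_none_iff_exists'.1 hω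
    exact ⟨(ω, c), hc, rfl⟩

theorem isFractionalColoring_outcomeColors [Fintype Ω] [Nonempty Ω] {Δ : ℕ} [NeZero Δ]
    {χ : Ω → V → Option (Fin Δ)} (hχ : ∀ ω, IsProper G (χ ω)) {ε : ℝ} (hε : 0 < ε)
    (hfail : ∀ v, prob {ω | χ ω v = none} ≤ ε / (Δ + ε)) :
    IsFractionalColoring G (Δ + ε) fun v => encodeColors (outcomeColors χ v) := by
  have hΔ : (1 : ℝ) ≤ Δ := by exact_mod_cast Nat.one_le_iff_ne_zero.2 (NeZero.ne Δ)
  refine isFractionalColoring_encodeColors (by linarith) (fun v => ?_) fun v w hvw => ?_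
  · have hΩ : (0 : ℝ) < Fintype.card Ω := by exact_mod_cast Fintype.card_pos
    have hnone := hfail v
    rw [prob_eq_card_div, div_le_div_iff₀ hΩ (by linarith)] at hnone
    have htotal : ({ω | χ ω v = none}.ncard : ℝ) + {ω | χ ω v = none}ᶜ.ncard =
        Fintype.card Ω := by
      exact_mod_cast (Set.ncard_add_ncard_compl _).trans Nat.card_eq_fintype_card
    rw [ncard_outcomeColors, Nat.card_prod, Nat.card_eq_fintype_card, Nat.card_fin]
    push_cast
    linear_combination hnone - (Δ + ε) * htotal
  · exact Set.disjoint_left.2 fun x hv hw => hχ x.1 hvw hv hw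

end RandomColoring

section Permutations

variable {V : Type*} [LinearOrder V] {G : SimpleGraph V} {v w : V} {S : Set V}

/-- The permutations that rank `v` before all other elements of `S`. -/
def permsMin (S : Set V) (v : V) : Set (Equiv.Perm V) :=
  {π | ∀ u ∈ S, π v ≤ π u}

/-- The permutations that rank `v` before all its neighbours. -/
def permsFirst (G : SimpleGraph V) (v : V) : Set (Equiv.Perm V) :=
  {π | ∀ u, G.Adj v u → π v < π u}

theorem disjoint_permsFirst (h : G.Adj v w) : Disjoint (permsFirst G v) (permsFirst G w) :=
  Set.disjoint_left.2 fun _ hv hw => lt_asymm (hv w h) (hw v h.symm)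

theorem permsMin_subset_permsFirst : permsMin (insert v (G.neighborSet v)) v ⊆ permsFirst G v :=
  fun π hπ u hu => lt_of_le_of_ne (hπ u (Set.mem_insert_of_mem v hu)) fun e =>
    hu.ne (π.injective e)

variable [Finite V]

theorem ncard_permsMin_le (hv : v ∈ S) (hw : w ∈ S) :
    (permsMin S w).ncard ≤ (permsMin S v).ncard := by
  refine Set.ncard_le_ncard_of_injOn (fun π => π * Equiv.swap v w) (fun π hπ u hu => ?_)
    (fun π _ π' _ e => mul_right_cancel e) (Set.toFinite _)
  rw [Equiv.Perm.mul_apply, Equiv.Perm.mul_apply, Equiv.swap_apply_left]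
  refine hπ _ ?_
  rcases eq_or_ne u v with rfl | huv
  · rwa [Equiv.swap_apply_left]
  rcases eq_or_ne u w with rfl | huw
  · rwa [Equiv.swap_apply_right]
  · rwa [Equiv.swap_apply_of_ne_of_ne huv huw]

theorem card_perm_le_ncard_mul (hv : v ∈ S) :
    Nat.card (Equiv.Perm V) ≤ S.ncard * (permsMin S v).ncard := by
  have hcover : Set.univ ⊆ ⋃ w ∈ (Set.toFinite S).toFinset, permsMin S w := by
    intro π _
    obtain ⟨w, hw, hmin⟩ := (Set.toFinite S).exists_minimalFor π S ⟨v, hv⟩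
    refine Set.mem_biUnion ((Set.Finite.mem_toFinset _).2 hw) fun u hu => ?_
    exact (le_total (π w) (π u)).elim _root_.id fun h => hmin hu h
  calc Nat.card (Equiv.Perm V)
      ≤ (⋃ w ∈ (Set.toFinite S).toFinset, permsMin S w).ncard := by
        rw [← Set.ncard_univ]
        exact Set.ncard_le_ncard hcover (Set.toFinite _)
    _ ≤ ∑ w ∈ (Set.toFinite S).toFinset, (permsMin S w).ncard :=
        Finset.set_ncard_biUnion_le _ _
    _ ≤ (Set.toFinite S).toFinset.card • (permsMin S v).ncard :=
        Finset.sum_le_card_nsmul _ _ _ fun w hw =>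
          ncard_permsMin_le hv ((Set.Finite.mem_toFinset _).1 hw)
    _ = S.ncard * (permsMin S v).ncard := by
        rw [← Set.ncard_eq_toFinset_card, smul_eq_mul]

theorem card_perm_le_mul_ncard_permsFirst {Δ : ℕ} (hΔ : (G.neighborSet v).ncard ≤ Δ) :
    Nat.card (Equiv.Perm V) ≤ (Δ + 1) * (permsFirst G v).ncard :=
  calc Nat.card (Equiv.Perm V)
      ≤ (insert v (G.neighborSet v)).ncard * (permsMin (insert v (G.neighborSet v)) v).ncard :=
        card_perm_le_ncard_mul (Set.mem_insert v _)
    _ ≤ (Δ + 1) * (permsFirst G v).ncard :=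
        Nat.mul_le_mul ((Set.ncard_insert_le _ _).trans (Nat.add_le_add_right hΔ 1))
          (Set.ncard_le_ncard permsMin_subset_permsFirst (Set.toFinite _))

end Permutations

theorem isFractionalColoring_permsFirst {N Δ : ℕ} {G : SimpleGraph (Fin N)}
    (hΔ : ∀ v, (G.neighborSet v).ncard ≤ Δ) {ε : ℝ} (hε : 1 ≤ ε) :
    IsFractionalColoring G (Δ + ε) fun v => encodeColors (permsFirst G v) := by
  refine isFractionalColoring_encodeColors
    (hε.trans (le_add_of_nonneg_left (Nat.cast_nonneg _))) (fun v => ?_)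
    fun v w hvw => disjoint_permsFirst hvw
  calc (Nat.card (Equiv.Perm (Fin N)) : ℝ) ≤ (Δ + 1) * (permsFirst G v).ncard := by
        exact_mod_cast card_perm_le_mul_ncard_permsFirst (hΔ v)
    _ ≤ (Δ + ε) * (permsFirst G v).ncard := by gcongr

theorem locallyComputable_permsFirst {N : ℕ} [NeZero N] :
    LocallyComputable.{u} 1 fun (G : SimpleGraph (Fin N)) v => permsFirst G v :=
  .comp₂ (fun (v : Fin N) (a : Fin N → Prop) => {π : Equiv.Perm (Fin N) | ∀ u, a u → π v < π u})
    .id .adj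

/-! ### The choice of the parameters and the number of rounds -/

theorem clog_two_pos {Δ : ℕ} (hΔ : 3 ≤ Δ) : 1 ≤ Nat.clog 2 Δ :=
  Nat.clog_pos (by norm_num) (by omega)

namespace Params

/-- The parameters for `Δ` colours and failure probability `O(Δ ^ (-k))`. -/
def ofExponent {Δ : ℕ} (hΔ : 3 ≤ Δ) (k : ℕ) : Params where
  Δ := Δ
  g := 8 * k
  b := (2 * (16 * k + 1) + k) * Nat.clog 2 Δ
  Q := Δ ^ k
  K := 4 * k * Nat.clog 2 Δ
  three_le := hΔ
  Q_pos := by positivity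

section OfExponent

variable {Δ : ℕ} (hΔ : 3 ≤ Δ) {k : ℕ}

theorem radius_ofExponent_add_one_le (hk : 1 ≤ k) :
    (ofExponent hΔ k).radius + 1 ≤ 10000 * (k ^ 3 * Nat.clog 2 Δ ^ 2) := by
  have hc := clog_two_pos hΔ
  have key : ∀ i ≤ 3, ∀ j ≤ 2, k ^ i * Nat.clog 2 Δ ^ j ≤ k ^ 3 * Nat.clog 2 Δ ^ 2 :=
    fun i hi j hj => Nat.mul_le_mul (Nat.pow_le_pow_right hk hi) (Nat.pow_le_pow_right hc hj)
  simp only [radius, R, α, ofExponent]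
  generalize Nat.clog 2 Δ = c at *
  linarith [key 0 (by simp) 0 (by simp), key 1 (by simp) 0 (by simp), key 0 (by simp) 1 (by simp),
    key 1 (by simp) 1 (by simp), key 2 (by simp) 1 (by simp), key 2 (by simp) 2 (by simp),
    key 1 (by simp) 2 (by simp)]

theorem pow_α_mul_Q_le_two_pow_b :
    (Δ + 1) ^ (ofExponent hΔ k).α * (ofExponent hΔ k).Q ≤ 2 ^ (ofExponent hΔ k).b :=
  calc (Δ + 1) ^ (2 * (8 * k) + 1) * Δ ^ k ≤ (Δ ^ 2) ^ (2 * (8 * k) + 1) * Δ ^ k :=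
        Nat.mul_le_mul_right _ (Nat.pow_le_pow_left (by nlinarith) _)
    _ = Δ ^ (2 * (16 * k + 1) + k) := by rw [← pow_mul, ← pow_add]; congr 1; ring
    _ ≤ (2 ^ Nat.clog 2 Δ) ^ (2 * (16 * k + 1) + k) :=
        Nat.pow_le_pow_left (Nat.le_pow_clog (by norm_num) Δ) _
    _ = 2 ^ ((2 * (16 * k + 1) + k) * Nat.clog 2 Δ) := by rw [← pow_mul, mul_comm]

include hΔ in
theorem sq_pow_le_sub_one_pow : (Δ ^ k) ^ 2 ≤ (Δ - 1) ^ (4 * k) := by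
  have hsq : Δ ≤ (Δ - 1) ^ 2 := by
    obtain ⟨d, rfl⟩ : ∃ d, Δ = d + 1 := ⟨Δ - 1, by omega⟩
    rw [Nat.add_sub_cancel]
    nlinarith
  calc (Δ ^ k) ^ 2 ≤ (((Δ - 1) ^ 2) ^ k) ^ 2 :=
        Nat.pow_le_pow_left (Nat.pow_le_pow_left hsq _) _
    _ = (Δ - 1) ^ (4 * k) := by rw [← pow_mul, ← pow_mul]; congr 1; ring

theorem three_fourths_pow_K_le :
    (3 / 4 : ℝ) ^ (ofExponent hΔ k).K ≤ 1 / ((ofExponent hΔ k).Q : ℝ) := by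
  have hQ : ((Δ ^ k : ℕ) : ℝ) ≤ 2 ^ (k * Nat.clog 2 Δ) := by
    rw [mul_comm k, pow_mul]
    exact_mod_cast Nat.pow_le_pow_left (Nat.le_pow_clog (by norm_num) Δ) k
  calc (3 / 4 : ℝ) ^ (4 * k * Nat.clog 2 Δ) = ((3 / 4) ^ 4) ^ (k * Nat.clog 2 Δ) := by
        rw [mul_assoc, pow_mul]
    _ ≤ (1 / 2) ^ (k * Nat.clog 2 Δ) := by gcongr; norm_num
    _ = 1 / 2 ^ (k * Nat.clog 2 Δ) := one_div_pow _ _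
    _ ≤ 1 / ((Δ ^ k : ℕ) : ℝ) := one_div_le_one_div_of_le (by positivity) hQ

theorem prob_coloring_ofExponent_eq_none_le {V : Type*} [Fintype V] [DecidableEq V]
    {G : SimpleGraph V} (hdeg : ∀ v, (G.neighborSet v).ncard ≤ Δ) (hG : G.CliqueFree (Δ + 1))
    (v : V) :
    prob {ω : (ofExponent hΔ k).Seed V | (ofExponent hΔ k).coloring ω G v = none} ≤
      3 / (Δ : ℝ) ^ k := by
  have h := (ofExponent hΔ k).prob_coloring_eq_none_le hdeg hG (pow_α_mul_Q_le_two_pow_b hΔ)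
    (k := 4 * k) (Nat.le_of_eq (by simp only [ofExponent]; ring)) (sq_pow_le_sub_one_pow hΔ)
    (three_fourths_pow_K_le hΔ) v
  rwa [show ((ofExponent hΔ k).Q : ℝ) = (Δ : ℝ) ^ k from Nat.cast_pow Δ k] at h

end OfExponent

end Params

/-- An exponent `k` for which the failure probability `O(Δ ^ (-k))` is at most `ε / (Δ + ε)`. -/
noncomputable def exponent (ε : ℝ) (Δ : ℕ) : ℕ :=
  3 + ⌈Real.log (1 / ε) / Real.log Δ⌉₊

open Classical in
/-- The number of rounds of the algorithm for fractional `(Δ + ε)`-colouring. A function of a graph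
that is determined at distance `r` is computed in `r + 1` rounds, as a node learns its neighbours
only in the first round. -/
noncomputable def rounds (ε : ℝ) (Δ : ℕ) : ℕ :=
  if h : 3 ≤ Δ ∧ ε < 1 then (Params.ofExponent h.1 (exponent ε Δ)).radius + 1 else 1

theorem rounds_of_one_le {ε : ℝ} (hε : 1 ≤ ε) (Δ : ℕ) : rounds ε Δ = 1 :=
  dif_neg fun h => h.2.not_ge hε

theorem bounds_comparable {x y : ℝ} (hx : 0 < x) (hy : 0 ≤ y) :
    (x + y ^ 2 / x) * (x + y) ≤ 2 * (x ^ 2 + y ^ 2 + y ^ 3 / x) ∧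
      x ^ 2 + y ^ 2 + y ^ 3 / x ≤ (x + y ^ 2 / x) * (x + y) := by
  have hexpand : (x + y ^ 2 / x) * (x + y) = x ^ 2 + y ^ 2 + y ^ 3 / x + x * y := by
    field_simp
    ring
  have hcube : 0 ≤ y ^ 3 / x := by positivity
  have hmul : 0 ≤ x * y := by positivity
  exact ⟨by nlinarith [sq_nonneg (x - y)], by linarith⟩

theorem cube_div_le_mul {x y : ℝ} (hx : 0 < x) (hy : 0 ≤ y) :
    (x + y) ^ 3 / x ≤ 2 * ((x + y ^ 2 / x) * (x + y)) := by
  rw [div_le_iff₀ hx]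
  calc (x + y) ^ 3 = (x + y) ^ 2 * (x + y) := by ring
    _ ≤ 2 * (x ^ 2 + y ^ 2) * (x + y) := by gcongr; exact add_sq_le
    _ = 2 * ((x + y ^ 2 / x) * (x + y)) * x := by field_simp

section Logarithms

variable {Δ : ℕ} (hΔ : 3 ≤ Δ)

include hΔ

theorem one_le_log_natCast : 1 ≤ Real.log Δ := by
  have h : (3 : ℝ) ≤ Δ := by exact_mod_cast hΔ
  rw [Real.le_log_iff_exp_le (by linarith)]
  linarith [Real.exp_one_lt_d9]

theorem clog_two_le : (Nat.clog 2 Δ : ℝ) ≤ 3 * Real.log Δ := by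
  have hc : (1 : ℝ) ≤ Nat.clog 2 Δ := by exact_mod_cast clog_two_pos hΔ
  have hpow : (2 : ℝ) ^ (Nat.clog 2 Δ - 1) ≤ Δ := by
    exact_mod_cast (Nat.pow_pred_clog_lt_self (by norm_num) (by omega)).le
  have hlog := Real.log_le_log (by positivity) hpow
  rw [Real.log_pow, Nat.cast_sub (clog_two_pos hΔ), Nat.cast_one] at hlog
  nlinarith [one_le_log_natCast hΔ, Real.log_two_gt_d9]

theorem log_natCast_div {ε : ℝ} (hε : 0 < ε) :
    Real.log (Δ / ε) = Real.log Δ + Real.log (1 / ε) := by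
  rw [div_eq_mul_one_div, Real.log_mul (by positivity) (by positivity)]

theorem log_one_div_le_mul_log {a ε : ℝ} (hε : 1 / (Δ : ℝ) ^ a < ε) :
    Real.log (1 / ε) ≤ a * Real.log Δ := by
  have hε0 : 0 < ε := lt_trans (by positivity) hε
  rw [← Real.log_rpow (by positivity)]
  exact Real.log_le_log (by positivity) ((one_div_lt (by positivity) hε0).1 hε).le

theorem bounds_comparable_of_le_one {ε : ℝ} (hε : 0 < ε) (hε1 : ε ≤ 1) :
    (Real.log Δ + Real.log (1 / ε) ^ 2 / Real.log Δ) * Real.log (Δ / ε) ≤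
        2 * (Real.log Δ ^ 2 + Real.log (1 / ε) ^ 2 + Real.log (1 / ε) ^ 3 / Real.log Δ) ∧
      Real.log Δ ^ 2 + Real.log (1 / ε) ^ 2 + Real.log (1 / ε) ^ 3 / Real.log Δ ≤
        2 * ((Real.log Δ + Real.log (1 / ε) ^ 2 / Real.log Δ) * Real.log (Δ / ε)) := by
  have hx : 0 < Real.log Δ := by linarith [one_le_log_natCast hΔ]
  have hy : 0 ≤ Real.log (1 / ε) := Real.log_nonneg (one_le_one_div hε hε1)
  rw [log_natCast_div hΔ hε]
  obtain ⟨hle, hge⟩ := bounds_comparable hx hy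
  exact ⟨hle, hge.trans (le_mul_of_one_le_left (by positivity) one_le_two)⟩

end Logarithms

section Rounds

variable {ε : ℝ} {Δ : ℕ} (hΔ : 3 ≤ Δ)

include hΔ

theorem rounds_of_lt_one (hε1 : ε < 1) :
    rounds ε Δ = (Params.ofExponent hΔ (exponent ε Δ)).radius + 1 :=
  dif_pos ⟨hΔ, hε1⟩

theorem three_div_pow_exponent_le (hε : 0 < ε) (hε1 : ε < 1) :
    3 / (Δ : ℝ) ^ exponent ε Δ ≤ ε / (Δ + ε) := by
  have hΔ' : (3 : ℝ) ≤ Δ := by exact_mod_cast hΔ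
  have hlog := one_le_log_natCast hΔ
  have hpow : 1 ≤ ε * (Δ : ℝ) ^ ⌈Real.log (1 / ε) / Real.log Δ⌉₊ := by
    rw [← div_le_iff₀' hε, ← Real.log_le_log_iff (by positivity) (by positivity), Real.log_pow,
      ← div_le_iff₀ (by linarith)]
    exact Nat.le_ceil _
  have hcube : 3 * (Δ + ε) ≤ (Δ : ℝ) ^ 3 := by nlinarith [mul_self_nonneg ((Δ : ℝ) - 3)]
  rw [exponent, pow_add, div_le_div_iff₀ (by positivity) (by linarith)]
  calc 3 * (Δ + ε) ≤ (Δ : ℝ) ^ 3 * 1 := by rwa [mul_one]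
    _ ≤ (Δ : ℝ) ^ 3 * (ε * (Δ : ℝ) ^ ⌈Real.log (1 / ε) / Real.log Δ⌉₊) := by gcongr
    _ = ε * ((Δ : ℝ) ^ 3 * (Δ : ℝ) ^ ⌈Real.log (1 / ε) / Real.log Δ⌉₊) := by ring

theorem exponent_mul_log_le (hε : 0 < ε) (hε1 : ε ≤ 1) :
    exponent ε Δ * Real.log Δ ≤ 4 * (Real.log Δ + Real.log (1 / ε)) := by
  have hx : 0 < Real.log Δ := by linarith [one_le_log_natCast hΔ]
  have hy : 0 ≤ Real.log (1 / ε) := Real.log_nonneg (one_le_one_div hε hε1)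
  have hk : (exponent ε Δ : ℝ) ≤ 4 + Real.log (1 / ε) / Real.log Δ := by
    rw [exponent]
    push_cast
    linarith [Nat.ceil_lt_add_one (div_nonneg hy hx.le)]
  calc exponent ε Δ * Real.log Δ ≤ (4 + Real.log (1 / ε) / Real.log Δ) * Real.log Δ := by gcongr
    _ = 4 * Real.log Δ + Real.log (1 / ε) := by field_simp
    _ ≤ 4 * (Real.log Δ + Real.log (1 / ε)) := by linarith

theorem rounds_le_of_lt_one (hε : 0 < ε) (hε1 : ε < 1) :
    (rounds ε Δ : ℝ) ≤ 12000000 *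
      ((Real.log Δ + Real.log (1 / ε) ^ 2 / Real.log Δ) * Real.log (Δ / ε)) := by
  have hx : 0 < Real.log Δ := by linarith [one_le_log_natCast hΔ]
  have hy : 0 ≤ Real.log (1 / ε) := Real.log_nonneg (one_le_one_div hε hε1.le)
  have hk := exponent_mul_log_le hΔ hε hε1.le
  have hc := clog_two_le hΔ
  have hrounds : (rounds ε Δ : ℝ) ≤ 10000 * (exponent ε Δ ^ 3 * Nat.clog 2 Δ ^ 2) := by
    rw [rounds_of_lt_one hΔ hε1]
    exact_mod_cast Params.radius_ofExponent_add_one_le hΔ (k := exponent ε Δ)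
      (by rw [exponent]; omega)
  rw [log_natCast_div hΔ hε]
  set x := Real.log Δ
  set y := Real.log (1 / ε)
  have hpos : 0 ≤ (x + y ^ 2 / x) * (x + y) := by positivity
  calc (rounds ε Δ : ℝ) ≤ 10000 * (exponent ε Δ ^ 3 * (3 * x) ^ 2) := hrounds.trans (by gcongr)
    _ = 90000 * ((exponent ε Δ * x) ^ 3 / x) := by field_simp; ring
    _ ≤ 90000 * ((4 * (x + y)) ^ 3 / x) := by gcongr
    _ = 5760000 * ((x + y) ^ 3 / x) := by ring
    _ ≤ 5760000 * (2 * ((x + y ^ 2 / x) * (x + y))) := by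
        gcongr
        exact cube_div_le_mul hx hy
    _ ≤ 12000000 * ((x + y ^ 2 / x) * (x + y)) := by linarith

theorem rounds_le_max (hε : 0 < ε) :
    (rounds ε Δ : ℝ) ≤ 24000000 * max 1
        ((Real.log Δ + Real.log (1 / ε) ^ 2 / Real.log Δ) * Real.log (Δ / ε)) ∧
      (rounds ε Δ : ℝ) ≤ 24000000 * max 1
        (Real.log Δ ^ 2 + Real.log (1 / ε) ^ 2 + Real.log (1 / ε) ^ 3 / Real.log Δ) := by
  rcases lt_or_ge ε 1 with hε1 | hε1
  · have hle := rounds_le_of_lt_one hΔ hε hε1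
    have hcomp := (bounds_comparable_of_le_one hΔ hε hε1.le).1
    set A := (Real.log Δ + Real.log (1 / ε) ^ 2 / Real.log Δ) * Real.log (Δ / ε)
    set B := Real.log Δ ^ 2 + Real.log (1 / ε) ^ 2 + Real.log (1 / ε) ^ 3 / Real.log Δ
    constructor
    · linarith [le_max_right 1 A, le_max_left 1 A]
    · linarith [le_max_right 1 B]
  · rw [rounds_of_one_le hε1, Nat.cast_one]
    have hone (z : ℝ) : 1 ≤ 24000000 * max 1 z := by linarith [le_max_left 1 z]
    exact ⟨hone _, hone _⟩

theorem rounds_le_of_one_div_rpow_lt {a : ℝ} (ha : 0 < a) (hε : 1 / (Δ : ℝ) ^ a < ε) :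
    (rounds ε Δ : ℝ) ≤ 12000000 * ((1 + a ^ 2) * (1 + a)) * Real.log Δ ^ 2 := by
  have hlog := one_le_log_natCast hΔ
  have hε0 : 0 < ε := lt_trans (by positivity) hε
  rcases lt_or_ge ε 1 with hε1 | hε1
  · refine (rounds_le_of_lt_one hΔ hε0 hε1).trans ?_
    have hy : 0 ≤ Real.log (1 / ε) := Real.log_nonneg (one_le_one_div hε0 hε1.le)
    have hya := log_one_div_le_mul_log hΔ hε
    rw [log_natCast_div hΔ hε0]
    set x := Real.log Δ
    set y := Real.log (1 / ε)
    calc 12000000 * ((x + y ^ 2 / x) * (x + y))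
        ≤ 12000000 * ((x + (a * x) ^ 2 / x) * (x + a * x)) := by gcongr
      _ = 12000000 * ((1 + a ^ 2) * (1 + a)) * x ^ 2 := by field_simp
  · rw [rounds_of_one_le hε1, Nat.cast_one]
    have ha1 : 1 ≤ (1 + a ^ 2) * (1 + a) := by nlinarith [sq_nonneg a, pow_pos ha 3]
    nlinarith [sq_nonneg (Real.log Δ)]

end Rounds

/-! ### The LOCAL algorithm -/

theorem ncard_neighborSet_map_le_maxDegree {V W : Type*} [Fintype V] {G : SimpleGraph V}
    [DecidableRel G.Adj] (e : V ↪ W) (x : W) :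
    ((G.map e).neighborSet x).ncard ≤ G.maxDegree := by
  by_cases hx : ∃ v, e v = x
  · obtain ⟨v, rfl⟩ := hx
    rw [SimpleGraph.neighborSet_map, Set.ncard_image_of_injective _ e.injective,
      Set.ncard_eq_toFinset_card']
    exact G.degree_le_maxDegree v
  · have hempty : (G.map e).neighborSet x = ∅ :=
      Set.eq_empty_of_forall_notMem fun y ⟨_, a, _, _, ha, _⟩ => hx ⟨a, ha⟩
    simp [hempty]

theorem IsFractionalColoring.of_map {V W : Type*} {G : SimpleGraph V} {e : V ↪ W} {r : ℝ}
    {X : W → Finset ℕ} (h : IsFractionalColoring (G.map e) r X) :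
    IsFractionalColoring G r fun v => X (e v) := by
  obtain ⟨p, q, ⟨hq, hqp, hsub, hcard, hdisj⟩, hr⟩ := h
  exact ⟨p, q, ⟨hq, hqp, fun v => hsub _, fun v => hcard _,
    fun v w hvw => hdisj _ _ (SimpleGraph.map_adj_apply.2 hvw)⟩, hr⟩

theorem Params.locallyComputable_outcomeColors (P : Params) {N : ℕ} [NeZero N] :
    LocallyComputable.{u} (P.radius + 1) fun (G : SimpleGraph (Fin N)) v =>
      outcomeColors (fun ω : P.Seed (Fin N) => P.coloring ω G) v :=
  .comp (fun χ : P.Seed (Fin N) → Option (Fin P.Δ) =>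
      {x : P.Seed (Fin N) × Fin P.Δ | χ x.1 = some x.2})
    (.of_isLocal (f := fun G v ω => P.coloring ω G v) fun _ _ _ hG =>
      funext fun ω => P.isLocal_coloring ω hG)

theorem exists_locallyComputable_isFractionalColoring {ε : ℝ} (hε : 0 < ε) (N : ℕ) [NeZero N]
    {Δ : ℕ} (hΔ : 3 ≤ Δ) :
    ∃ X : SimpleGraph (Fin N) → Fin N → Finset ℕ, LocallyComputable.{u} (rounds ε Δ) X ∧
      ∀ G : SimpleGraph (Fin N), (∀ v, (G.neighborSet v).ncard ≤ Δ) →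
        (ε < 1 → G.CliqueFree (Δ + 1)) → IsFractionalColoring G (Δ + ε) (X G) := by
  rcases lt_or_ge ε 1 with hε1 | hε1
  · let P := Params.ofExponent hΔ (exponent ε Δ)
    rw [rounds_of_lt_one hΔ hε1]
    refine ⟨_, P.locallyComputable_outcomeColors.comp encodeColors, fun G hdeg hG => ?_⟩
    exact isFractionalColoring_outcomeColors (fun _ => P.isProper_coloring) hε fun v =>
      (Params.prob_coloring_ofExponent_eq_none_le hΔ hdeg (hG hε1) v).trans
        (three_div_pow_exponent_le hΔ hε hε1)
  · rw [rounds_of_one_le hε1]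
    exact ⟨_, locallyComputable_permsFirst.comp encodeColors,
      fun G hdeg _ => isFractionalColoring_permsFirst hdeg hε1⟩

theorem exists_algorithm {ε : ℝ} (hε : 0 < ε) (c : ℕ) : ∃ A : LocalAlgorithm (Finset ℕ),
    ∀ (V : Type u) [Fintype V] (G : SimpleGraph V) [DecidableRel G.Adj]
      (port : PortNumbering G) (ident : V → ℕ),
      IsIdAssignment c ident → 3 ≤ G.maxDegree →
      (ε < 1 → G.CliqueFree (G.maxDegree + 1)) →
      IsFractionalColoring G (G.maxDegree + ε)
        (A.outputAfter G port ident (rounds ε G.maxDegree)) := by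
  choose X hX hcol using fun (n Δ : ℕ) (hΔ : 3 ≤ Δ) =>
    exists_locallyComputable_isFractionalColoring.{u} hε (n ^ c + 1) hΔ
  choose D hD using hX
  refine ⟨View.gather fun w => if h : 3 ≤ w.maxDegree then D w.order w.maxDegree h w else ∅, ?_⟩
  intro V _ G _ port ident hid hΔ hfree
  let e : V ↪ Fin (Fintype.card V ^ c + 1) :=
    ⟨fun v => ⟨ident v, Nat.lt_succ_of_le (hid.2 v).2⟩, fun v w h => hid.1 (Fin.mk.inj h)⟩
  have : Nonempty V := by
    by_contra hV
    rw [not_nonempty_iff] at hV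
    rw [SimpleGraph.maxDegree_of_subsingleton] at hΔ
    omega
  have hmap := (hcol (Fintype.card V) G.maxDegree hΔ (G.map e)
    (ncard_neighborSet_map_le_maxDegree e)
    fun hε1 => SimpleGraph.cliqueFree_map_iff.2 (hfree hε1)).of_map
  convert hmap using 1
  funext v
  rw [View.outputAfter_gather, View.order_after, View.maxDegree_after, dif_pos hΔ]
  exact (hD (Fintype.card V) G.maxDegree hΔ V G port e v).symm

theorem mainTheorem1 :
    ∃ T : ℝ → ℕ → ℕ,
      -- the number of rounds `T ε Δ` satisfies both time bounds
      (∃ C : ℝ, 0 < C ∧ ∀ ε : ℝ, 0 < ε → ∀ Δ : ℕ, 3 ≤ Δ →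
        (T ε Δ : ℝ) ≤ C * max 1
          ((Real.log Δ + Real.log (1 / ε) ^ 2 / Real.log Δ) * Real.log (Δ / ε)) ∧
        (T ε Δ : ℝ) ≤ C * max 1
          (Real.log Δ ^ 2 + Real.log (1 / ε) ^ 2 + Real.log (1 / ε) ^ 3 / Real.log Δ)) ∧
      -- the two time bounds are of the same order
      (∃ C : ℝ, 0 < C ∧ ∀ ε : ℝ, 0 < ε → ε ≤ 1 → ∀ Δ : ℕ, 3 ≤ Δ →
        (Real.log Δ + Real.log (1 / ε) ^ 2 / Real.log Δ) * Real.log (Δ / ε) ≤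
          C * (Real.log Δ ^ 2 + Real.log (1 / ε) ^ 2 + Real.log (1 / ε) ^ 3 / Real.log Δ) ∧
        Real.log Δ ^ 2 + Real.log (1 / ε) ^ 2 + Real.log (1 / ε) ^ 3 / Real.log Δ ≤
          C * ((Real.log Δ + Real.log (1 / ε) ^ 2 / Real.log Δ) * Real.log (Δ / ε))) ∧
      -- for `ε > 1 / Δ ^ a` the bound is `O(log² Δ)`
      (∀ a : ℝ, 0 < a → ∃ C : ℝ, 0 < C ∧ ∀ Δ : ℕ, 3 ≤ Δ → ∀ ε : ℝ, 1 / (Δ : ℝ) ^ a < ε →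
        (T ε Δ : ℝ) ≤ C * Real.log Δ ^ 2) ∧
      -- a deterministic algorithm computes the coloring within `T ε Δ` rounds
      (∀ ε : ℝ, 0 < ε → ∀ c : ℕ, 1 ≤ c → ∃ A : LocalAlgorithm (Finset ℕ),
        ∀ (V : Type u) [Fintype V] (G : SimpleGraph V) [DecidableRel G.Adj]
          (port : PortNumbering G) (ident : V → ℕ),
          IsIdAssignment c ident → 3 ≤ G.maxDegree →
          (ε < 1 → G.CliqueFree (G.maxDegree + 1)) →
          IsFractionalColoring G (G.maxDegree + ε)
            (A.outputAfter G port ident (T ε G.maxDegree))) :=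
  ⟨rounds,
    ⟨24000000, by norm_num, fun _ hε _ hΔ => rounds_le_max hΔ hε⟩,
    ⟨2, by norm_num, fun _ hε hε1 _ hΔ => bounds_comparable_of_le_one hΔ hε hε1⟩,
    fun a ha => ⟨12000000 * ((1 + a ^ 2) * (1 + a)), by positivity,
      fun _ hΔ _ hε => rounds_le_of_one_div_rpow_lt hΔ ha hε⟩,
    fun _ hε c _ => exists_algorithm hε c⟩
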